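/- Let $T=(V,E)$ be a tree with $n=|V|\ge 2$ vertices, given with a plane straight-line drawing: vertices are distinct points of $\mathbb{R}^2$, edges are the straight-line segments between their endpoints, no edge passes through a vertex other than its endpoints, and two distinct edges meet at most in a common endpoint. A curve is *self-approaching* if for every point $c$ on it the Euclidean distance to $c$ does not increase while the curve is traversed from its start to $c$; it is *increasing-chord* if it is self-approaching in both directions. A subtree of $T$ is *increasing-chord* if every two of its vertices are joined in it by a path whose drawing is an increasing-chord curve. Two edge-disjoint subtrees have a *proper contact* at a common vertex $v$ if $v$ is a leaf of at least one of them. Call a partition of $E$ *admissible* if each of its parts is the edge set of an increasing-chord subtree of $T$ and all contacts between distinct parts are proper, and let $\mathrm{OPT}$ be the minimum number of parts of an admissible partition. There is an algorithm that, given the list of edges of $T$ and the coordinates of the vertices, computes an admissible partition of $E$ with at most $2\cdot\mathrm{OPT}-1$ parts in time polynomial in $n$. Here time is the number of operations on a real RAM (exact arithmetic and comparisons on real numbers at unit cost; natural numbers with addition, subtraction and comparison for counting and indirect addressing; only integer constants; no conversion of reals into integers). -/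

import Mathlib

/-! ### Straight-line drawings, increasing-chord subtrees, proper contacts -/

namespace TreeDrawing

/-- The Euclidean plane. -/
abbrev Plane : Type := EuclideanSpace ℝ (Fin 2)

/-- `pos` is a plane straight-line drawing of the graph `G`: distinct vertices are distinct points,
an edge (drawn as a segment) passes through no vertex other than its endpoints, and two distinct
edges have no common point except a common endpoint. -/
structure IsPlaneDrawing {V : Type*} (G : SimpleGraph V) (pos : V → Plane) : Prop where
  injective : Function.Injective pos
  vertex_on_edge : ∀ u v w : V, G.Adj u v → pos w ∈ segment ℝ (pos u) (pos v) → w = u ∨ w = v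
  edge_inter_edge : ∀ u v x y : V, G.Adj u v → G.Adj x y → s(u, v) ≠ s(x, y) →
    ∀ p : Plane, p ∈ segment ℝ (pos u) (pos v) → p ∈ segment ℝ (pos x) (pos y) →
      ∃ w : V, w ∈ s(u, v) ∧ w ∈ s(x, y) ∧ p = pos w

/-- The polygonal curve that draws a walk `v₀ v₁ … v_ℓ`, parametrised by `[0, ℓ]`: at time `i + r`
with `0 ≤ r < 1` it is at `(1 - r) • pos vᵢ + r • pos vᵢ₊₁`. -/
noncomputable def walkCurve {V : Type*} {G : SimpleGraph V} (pos : V → Plane) {u v : V}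
    (w : G.Walk u v) (t : ℝ) : Plane :=
  AffineMap.lineMap (pos (w.getVert ⌊t⌋₊)) (pos (w.getVert (⌊t⌋₊ + 1))) (Int.fract t)

/-- A curve on `[0, L]` is self-approaching: for every point `γ c` of it, the distance to `γ c`
does not increase while the curve is traversed from its start to `γ c`. -/
def IsSelfApproaching (γ : ℝ → Plane) (L : ℝ) : Prop :=
  ∀ c ∈ Set.Icc 0 L, AntitoneOn (fun t => dist (γ t) (γ c)) (Set.Icc 0 c)

/-- A curve on `[0, L]` has increasing chords: it is self-approaching in both directions. -/
def IsIncreasingChordCurve (γ : ℝ → Plane) (L : ℝ) : Prop :=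
  IsSelfApproaching γ L ∧ IsSelfApproaching (fun t => γ (L - t)) L

/-- A straight-line drawing of a graph is increasing-chord: every two vertices are joined by a path
whose drawing is an increasing-chord curve. -/
def IsIncreasingChordDrawing {V : Type*} (G : SimpleGraph V) (pos : V → Plane) : Prop :=
  ∀ u v : V, ∃ w : G.Walk u v, w.IsPath ∧ IsIncreasingChordCurve (walkCurve pos w) w.length

/-- The vertices incident to an edge of `F`. -/
abbrev partVerts {V : Type*} (F : Finset (Sym2 V)) : Set V :=
  (SimpleGraph.fromEdgeSet (F : Set (Sym2 V))).support

/-- The graph formed by the edges in `F` and their endpoints. -/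
abbrev partGraph {V : Type*} (F : Finset (Sym2 V)) : SimpleGraph (partVerts F) :=
  (SimpleGraph.fromEdgeSet (F : Set (Sym2 V))).induce (partVerts F)

/-- The edges in `F` form a tree whose drawing is increasing-chord. -/
def IsIncreasingChordSubtree {V : Type*} (pos : V → Plane) (F : Finset (Sym2 V)) : Prop :=
  (partGraph F).IsTree ∧ IsIncreasingChordDrawing (partGraph F) (fun v => pos v.1)

/-- `v` is a leaf of the subtree formed by the edges in `F`. -/
def IsLeafOf {V : Type*} (F : Finset (Sym2 V)) (v : V) : Prop :=
  ((SimpleGraph.fromEdgeSet (F : Set (Sym2 V))).neighborSet v).ncard = 1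

/-- Every contact of two parts of a plane drawing (that is, every common vertex) is proper:
the common vertex is a leaf in at least one of the two. -/
def ProperContact {V : Type*} (F₁ F₂ : Finset (Sym2 V)) : Prop :=
  ∀ v : V, v ∈ partVerts F₁ → v ∈ partVerts F₂ → IsLeafOf F₁ v ∨ IsLeafOf F₂ v

/-- A partition of the edges of `G` into increasing-chord subtrees that have only proper
contacts. -/
def IsProperDecomposition {V : Type*} [DecidableEq V] {G : SimpleGraph V} [Fintype G.edgeSet]
    (pos : V → Plane) (P : Finpartition G.edgeFinset) : Prop :=
  (∀ F ∈ P.parts, IsIncreasingChordSubtree pos F) ∧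
    ∀ F₁ ∈ P.parts, ∀ F₂ ∈ P.parts, F₁ ≠ F₂ → ProperContact F₁ F₂

/-- The minimum number of parts of a partition of the edges into increasing-chord subtrees with
only proper contacts. -/
noncomputable def optSize {V : Type*} [DecidableEq V] (G : SimpleGraph V) [Fintype G.edgeSet]
    (pos : V → Plane) : ℕ :=
  sInf {k : ℕ | ∃ P : Finpartition G.edgeFinset, IsProperDecomposition pos P ∧ P.parts.card = k}

end TreeDrawing

/-! ### Programs for a real RAM

The machine has natural-number variables and unbounded arrays, used for counting and addressing,
and unbounded arrays of real numbers. Naturals admit addition, truncated subtraction and comparison;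
reals admit the four field operations and comparison, each exact and at unit cost. Programs contain
only integer constants, and a real number is never converted into a natural number. -/

namespace RealRAM

/-- Expressions for natural numbers; `read a i` is the `i`-th cell of array number `a`. -/
inductive NExp : Type
  | const (c : ℕ)
  | var (x : ℕ)
  | read (a : ℕ) (i : NExp)
  | add (e f : NExp)
  | sub (e f : NExp)

/-- Expressions for real numbers; `read a i` is the `i`-th cell of the real array number `a`. -/
inductive RExp : Type
  | const (c : ℤ)
  | read (a : ℕ) (i : NExp)
  | add (e f : RExp)
  | sub (e f : RExp)
  | mul (e f : RExp)
  | div (e f : RExp)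

/-- Tests: comparisons of naturals and of reals, and their Boolean combinations. -/
inductive Test : Type
  | nle (e f : NExp)
  | rle (e f : RExp)
  | neg (b : Test)
  | conj (b c : Test)

/-- Programs. -/
inductive Cmd : Type
  | skip
  | setVar (x : ℕ) (e : NExp)
  | setNat (a : ℕ) (i e : NExp)
  | setReal (a : ℕ) (i : NExp) (e : RExp)
  | seq (p q : Cmd)
  | ite (b : Test) (p q : Cmd)
  | loop (b : Test) (p : Cmd)

/-- The contents of the memory. -/
structure State : Type where
  nvar : ℕ → ℕ
  narr : ℕ → ℕ → ℕ
  rarr : ℕ → ℕ → ℝ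

/-- The value of an expression. -/
def NExp.val (s : State) : NExp → ℕ
  | const c => c
  | var x => s.nvar x
  | read a i => s.narr a (i.val s)
  | add e f => e.val s + f.val s
  | sub e f => e.val s - f.val s

/-- The number of elementary operations needed to evaluate an expression. -/
def NExp.cost : NExp → ℕ
  | const _ => 1
  | var _ => 1
  | read _ i => i.cost + 1
  | add e f => e.cost + f.cost + 1
  | sub e f => e.cost + f.cost + 1

/-- The value of an expression (the quotient by zero is zero). -/
noncomputable def RExp.val (s : State) : RExp → ℝ
  | const c => (c : ℝ)
  | read a i => s.rarr a (i.val s)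
  | add e f => e.val s + f.val s
  | sub e f => e.val s - f.val s
  | mul e f => e.val s * f.val s
  | div e f => e.val s / f.val s

/-- The number of elementary operations needed to evaluate an expression. -/
def RExp.cost : RExp → ℕ
  | const _ => 1
  | read _ i => i.cost + 1
  | add e f => e.cost + f.cost + 1
  | sub e f => e.cost + f.cost + 1
  | mul e f => e.cost + f.cost + 1
  | div e f => e.cost + f.cost + 1

/-- The test succeeds. -/
def Test.Holds (s : State) : Test → Prop
  | nle e f => e.val s ≤ f.val s
  | rle e f => e.val s ≤ f.val s
  | neg b => ¬ b.Holds s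
  | conj b c => b.Holds s ∧ c.Holds s

/-- The number of elementary operations needed to evaluate a test. -/
def Test.cost : Test → ℕ
  | nle e f => e.cost + f.cost + 1
  | rle e f => e.cost + f.cost + 1
  | neg b => b.cost + 1
  | conj b c => b.cost + c.cost + 1

/-- `Exec p s t s'`: started in the state `s`, the program `p` halts after exactly `t` elementary
operations, and the memory is then `s'`. -/
inductive Exec : Cmd → State → ℕ → State → Prop
  | skip (s : State) : Exec .skip s 1 s
  | setVar (s : State) (x : ℕ) (e : NExp) :
      Exec (.setVar x e) s (e.cost + 1)
        { s with nvar := Function.update s.nvar x (e.val s) }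
  | setNat (s : State) (a : ℕ) (i e : NExp) :
      Exec (.setNat a i e) s (i.cost + e.cost + 1)
        { s with narr := Function.update s.narr a
                   (Function.update (s.narr a) (i.val s) (e.val s)) }
  | setReal (s : State) (a : ℕ) (i : NExp) (e : RExp) :
      Exec (.setReal a i e) s (i.cost + e.cost + 1)
        { s with rarr := Function.update s.rarr a
                   (Function.update (s.rarr a) (i.val s) (e.val s)) }
  | seq {p q : Cmd} {s s' s'' : State} {t t' : ℕ} :
      Exec p s t s' → Exec q s' t' s'' → Exec (.seq p q) s (t + t') s''
  | ite_true {b : Test} {p q : Cmd} {s s' : State} {t : ℕ} :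
      b.Holds s → Exec p s t s' → Exec (.ite b p q) s (b.cost + t) s'
  | ite_false {b : Test} {p q : Cmd} {s s' : State} {t : ℕ} :
      ¬ b.Holds s → Exec q s t s' → Exec (.ite b p q) s (b.cost + t) s'
  | loop_true {b : Test} {p : Cmd} {s s' s'' : State} {t t' : ℕ} :
      b.Holds s → Exec p s t s' → Exec (.loop b p) s' t' s'' →
        Exec (.loop b p) s (b.cost + t + t') s''
  | loop_false {b : Test} {p : Cmd} {s : State} :
      ¬ b.Holds s → Exec (.loop b p) s b.cost s

/-- The input: variable `0` holds the number `n` of vertices, the natural arrays `0` and `1` hold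
the two endpoints of the edges in the order in which the edges are listed, the real arrays `0` and
`1` hold the two coordinates of the vertices, and all other memory is zero. -/
noncomputable def inputState (n : ℕ) {m : ℕ} (ends : Fin m → Fin n × Fin n)
    (pos : Fin n → TreeDrawing.Plane) : State where
  nvar x := if x = 0 then n else 0
  narr a i :=
    if h : i < m then
      if a = 0 then (ends ⟨i, h⟩).1 else if a = 1 then (ends ⟨i, h⟩).2 else 0
    else 0
  rarr a v :=
    if h : v < n then
      if a = 0 then pos ⟨v, h⟩ 0 else if a = 1 then pos ⟨v, h⟩ 1 else 0
    else 0

/-- The output: the `i`-th cell of the natural array `2` is the label of the part that contains the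
`i`-th edge of the list, so that two edges have the same label exactly if they lie in the same part
of the partition `P`. -/
def OutputsPartition {V : Type*} [DecidableEq V] {m : ℕ} (s : State) (ends : Fin m → V × V)
    {E : Finset (Sym2 V)} (P : Finpartition E) : Prop :=
  ∀ i j : Fin m, s.narr 2 i = s.narr 2 j ↔
    ∃ F ∈ P.parts, s((ends i).1, (ends i).2) ∈ F ∧ s((ends j).1, (ends j).2) ∈ F

end RealRAM

/-!
An edge `f` can be in an increasing-chord subtree with the edge `e` only if both ends of `f` lie
beyond the same end of `e`, as seen in the direction of `e`; otherwise the two conflict. A subtree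
without conflicts is increasing-chord, so the task is to separate conflicting edges.

Root the tree and subdivide each edge by a node. Cutting some edges of the subdivision and giving
each edge of `T` to the component of its node partitions the edges; all contacts are proper since a
vertex `v` is a leaf of every part at `v` except that of its own component. Conversely, in an
admissible partition with `k` parts every vertex `v` can be given to a part such that `v` is a leaf
of all other parts at `v`. This colours the nodes of the subdivision, and the colour changes along
at most `k - 1` of its edges.

It remains to separate conflicting nodes greedily. Join the nodes to their children from the leaves
upwards, and whenever two conflicting nodes are about to meet at a node, cut the edges through which
they would come to it. In any proper colouring the two have different colours, and so the colour
changes on one of the two ways, in a component that has now been cut off. Hence there are at most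
twice as many cuts as colour changes, and at most `2 * (k - 1) + 1` components.
-/

/-! ### Polygonal curves -/

namespace TreeDrawing

open Set SimpleGraph

section Polyline

variable {E : Type*} [NormedAddCommGroup E] [InnerProductSpace ℝ E]

theorem dist_lineMap_sq (a b q : E) (r : ℝ) : dist (AffineMap.lineMap a b r) q ^ 2 =
    ‖q - b‖ ^ 2 + 2 * (1 - r) * inner ℝ (q - b) (b - a) + (1 - r) ^ 2 * ‖b - a‖ ^ 2 := by
  have h : AffineMap.lineMap a b r - q = -((q - b) + (1 - r) • (b - a)) := by
    rw [AffineMap.lineMap_apply_module']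
    module
  rw [dist_eq_norm, h, norm_neg, norm_add_sq_real, norm_smul, inner_smul_right, mul_pow,
    Real.norm_eq_abs, sq_abs]
  ring

theorem antitoneOn_dist_lineMap_iff {a b q : E} :
    AntitoneOn (fun t : ℝ => dist (AffineMap.lineMap a b t) q) (Icc 0 1) ↔
      0 ≤ inner ℝ (q - b) (b - a) := by
  constructor
  · intro h
    by_contra! hneg
    set g : ℝ := inner ℝ (q - b) (b - a)
    set N : ℝ := ‖b - a‖ ^ 2
    have hN : 0 ≤ N := sq_nonneg _
    -- The derivative of the squared distance at the end of the segment is `-2 * g`.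
    have near_end : ∀ ε : ℝ, 0 < ε → ε ≤ 1 → 0 ≤ 2 * g + ε * N := by
      intro ε h₀ h₁
      have hle := h (a := 1 - ε) ⟨by linarith, by linarith⟩ (b := 1) ⟨by norm_num, le_rfl⟩
        (by linarith)
      have hsq := pow_le_pow_left₀ dist_nonneg hle 2
      simp only [dist_lineMap_sq] at hsq
      exact nonneg_of_mul_nonneg_right (by nlinarith : 0 ≤ ε * (2 * g + ε * N)) h₀
    have h₁ := near_end (-g / (N - g)) (div_pos (by linarith) (by linarith))
      ((div_le_one (by linarith)).2 (by linarith))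
    have h₂ : -g / (N - g) * N ≤ -g := by
      rw [div_mul_eq_mul_div, div_le_iff₀ (by linarith)]
      nlinarith
    linarith
  · intro h s hs t ht hst
    refine le_of_sq_le_sq ?_ dist_nonneg
    rw [dist_lineMap_sq, dist_lineMap_sq]
    have h₁ : (1 - t) ^ 2 ≤ (1 - s) ^ 2 := by nlinarith [ht.2, hs.2]
    nlinarith [mul_nonneg (sub_nonneg.2 hst) h, mul_le_mul_of_nonneg_right h₁ (sq_nonneg ‖b - a‖)]

/-- The polygonal curve through the points `p 0, p 1, …`, which is at `p i` at time `i`. -/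
noncomputable def polyline (p : ℕ → E) (t : ℝ) : E :=
  AffineMap.lineMap (p ⌊t⌋₊) (p (⌊t⌋₊ + 1)) (Int.fract t)

theorem polyline_eq_lineMap (p : ℕ → E) {i : ℕ} {t : ℝ} (h₀ : (i : ℝ) ≤ t) (h₁ : t ≤ i + 1) :
    polyline p t = AffineMap.lineMap (p i) (p (i + 1)) (t - i) := by
  have ht : 0 ≤ t := (Nat.cast_nonneg i).trans h₀
  rcases h₁.lt_or_eq with h | rfl
  · have hf : ⌊t⌋₊ = i := (Nat.floor_eq_iff ht).2 ⟨h₀, h⟩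
    have hr : Int.fract t = t - i := by
      rw [← hf, ← Int.self_sub_floor, natCast_floor_eq_intCast_floor ht]
    rw [polyline, hf, hr]
  · have hf : ⌊(i : ℝ) + 1⌋₊ = i + 1 := by exact_mod_cast Nat.floor_natCast (R := ℝ) (i + 1)
    simp [polyline, hf]

theorem polyline_natCast (p : ℕ → E) (i : ℕ) : polyline p i = p i := by
  simp [polyline]

theorem antitoneOn_Icc_of_antitoneOn_Icc_natCast {f : ℝ → ℝ} {k : ℕ}
    (h : ∀ i < k, AntitoneOn f (Icc i (i + 1))) : AntitoneOn f (Icc 0 k) := by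
  induction k with
  | zero => simp
  | succ k ih =>
    have hk : (0 : ℝ) ≤ k := Nat.cast_nonneg k
    have hk' : (k : ℝ) ≤ k + 1 := by linarith
    have h' := (ih fun i hi => h i (by omega)).union_right (h k k.lt_succ_self)
      (isGreatest_Icc hk) (isLeast_Icc hk')
    rwa [Icc_union_Icc_eq_Icc hk hk', ← Nat.cast_succ] at h'

theorem antitoneOn_dist_polyline_of_inner_nonneg {p : ℕ → E} {i : ℕ} {q : E}
    (h : 0 ≤ inner ℝ (q - p (i + 1)) (p (i + 1) - p i)) :
    AntitoneOn (fun t => dist (polyline p t) q) (Icc i (i + 1)) := by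
  rintro s ⟨hs₀, hs₁⟩ t ⟨ht₀, ht₁⟩ hst
  have hanti := antitoneOn_dist_lineMap_iff.2 h
  have hle := hanti (a := s - i) ⟨by linarith, by linarith⟩ (b := t - i)
    ⟨by linarith, by linarith⟩ (by linarith)
  simpa only [polyline_eq_lineMap p hs₀ hs₁, polyline_eq_lineMap p ht₀ ht₁] using hle

theorem antitoneOn_dist_polyline_floor (p : ℕ → E) {c : ℝ} (hc : 0 ≤ c) :
    AntitoneOn (fun t => dist (polyline p t) (polyline p c)) (Icc ⌊c⌋₊ c) := by
  have hc₀ := Nat.floor_le hc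
  have hc₁ := (Nat.lt_floor_add_one c).le
  have dist_eq : ∀ r ∈ Icc (⌊c⌋₊ : ℝ) c,
      dist (polyline p r) (polyline p c) = (c - r) * dist (p ⌊c⌋₊) (p (⌊c⌋₊ + 1)) := by
    rintro r ⟨h₀, h₁⟩
    rw [polyline_eq_lineMap p h₀ (h₁.trans hc₁), polyline_eq_lineMap p hc₀ hc₁,
      dist_lineMap_lineMap, Real.dist_eq, abs_sub_comm, abs_of_nonneg (by linarith)]
    ring
  intro s hs t ht hst
  simp only [dist_eq s hs, dist_eq t ht]
  gcongr

theorem inner_polyline_sub_nonneg {p : ℕ → E} {x y : E} {c : ℝ}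
    (h₀ : 0 ≤ inner ℝ (p ⌊c⌋₊ - x) y) (h₁ : 0 ≤ inner ℝ (p (⌊c⌋₊ + 1) - x) y) :
    0 ≤ inner ℝ (polyline p c - x) y := by
  have h : polyline p c - x =
      (1 - Int.fract c) • (p ⌊c⌋₊ - x) + Int.fract c • (p (⌊c⌋₊ + 1) - x) := by
    rw [polyline, AffineMap.lineMap_apply_module]
    module
  rw [h, inner_add_left, real_inner_smul_left, real_inner_smul_left]
  exact add_nonneg (mul_nonneg (sub_nonneg.2 (Int.fract_lt_one c).le) h₀)
    (mul_nonneg (Int.fract_nonneg c) h₁)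

end Polyline

theorem isSelfApproaching_polyline {p : ℕ → Plane} {L : ℕ}
    (h : ∀ i < L, ∀ j, i + 1 ≤ j → 0 ≤ inner ℝ (p j - p (i + 1)) (p (i + 1) - p i)) :
    IsSelfApproaching (polyline p) L := by
  rintro c ⟨hc, hcL⟩
  have hfloor := Nat.floor_le hc
  have before : AntitoneOn (fun t => dist (polyline p t) (polyline p c)) (Icc 0 ⌊c⌋₊) := by
    refine antitoneOn_Icc_of_antitoneOn_Icc_natCast fun i hi => ?_
    have hiL : i < L := hi.trans_le (Nat.floor_le_of_le hcL)
    exact antitoneOn_dist_polyline_of_inner_nonneg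
      (inner_polyline_sub_nonneg (h i hiL _ hi) (h i hiL _ (by omega)))
  have h' := before.union_right (antitoneOn_dist_polyline_floor p hc)
    (isGreatest_Icc (Nat.cast_nonneg _)) (isLeast_Icc hfloor)
  rwa [Icc_union_Icc_eq_Icc (Nat.cast_nonneg _) hfloor] at h'

theorem inner_nonneg_of_isSelfApproaching_polyline {p : ℕ → Plane} {L : ℕ} (hL : 1 ≤ L)
    (h : IsSelfApproaching (polyline p) L) : 0 ≤ inner ℝ (p L - p 1) (p 1 - p 0) := by
  have hL' : (1 : ℝ) ≤ L := by exact_mod_cast hL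
  have h' := (h L ⟨by linarith, le_rfl⟩).mono (Icc_subset_Icc_right hL')
  refine antitoneOn_dist_lineMap_iff.1 (h'.congr fun r hr => ?_)
  have hr' := polyline_eq_lineMap p (i := 0) (by simpa using hr.1) (by simpa using hr.2)
  simp [hr', polyline_natCast]

section WalkCurve

variable {V : Type*} {G : SimpleGraph V}

theorem walkCurve_eq_polyline (pos : V → Plane) {u v : V} (w : G.Walk u v) :
    walkCurve pos w = polyline fun i => pos (w.getVert i) := rfl

theorem walkCurve_length_sub (pos : V → Plane) {u v : V} (w : G.Walk u v) {t : ℝ} (h₀ : 0 ≤ t)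
    (h₁ : t ≤ w.length) : walkCurve pos w (w.length - t) = walkCurve pos w.reverse t := by
  rw [walkCurve_eq_polyline, walkCurve_eq_polyline]
  rcases h₁.lt_or_eq with h | rfl
  · obtain ⟨k, hk⟩ : ∃ k, w.length = ⌊t⌋₊ + 1 + k :=
      Nat.exists_eq_add_of_le ((Nat.floor_lt h₀).2 h)
    have hk' : (w.length : ℝ) = ⌊t⌋₊ + 1 + k := by exact_mod_cast hk
    have hi₀ := Nat.floor_le h₀
    have hi₁ := (Nat.lt_floor_add_one t).le
    rw [polyline_eq_lineMap _ hi₀ hi₁, polyline_eq_lineMap _ (i := k) (by linarith) (by linarith)]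
    simp only [Walk.getVert_reverse]
    rw [show w.length - ⌊t⌋₊ = k + 1 by omega, show w.length - (⌊t⌋₊ + 1) = k by omega,
      ← AffineMap.lineMap_apply_one_sub]
    congr 1
    linarith
  · have h := polyline_natCast (fun i => pos (w.getVert i)) 0
    rw [Nat.cast_zero] at h
    rw [sub_self, h, polyline_natCast, Walk.getVert_reverse, Nat.sub_self]

theorem isIncreasingChordCurve_walkCurve_iff (pos : V → Plane) {u v : V} (w : G.Walk u v) :
    IsIncreasingChordCurve (walkCurve pos w) w.length ↔
      IsSelfApproaching (walkCurve pos w) w.length ∧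
        IsSelfApproaching (walkCurve pos w.reverse) w.reverse.length := by
  rw [IsIncreasingChordCurve, Walk.length_reverse]
  refine and_congr_right fun _ => forall₂_congr fun c hc => ?_
  have dist_eq : ∀ t ∈ Icc (0 : ℝ) c, dist (walkCurve pos w (w.length - t))
      (walkCurve pos w (w.length - c)) =
      dist (walkCurve pos w.reverse t) (walkCurve pos w.reverse c) := by
    intro t ht
    rw [walkCurve_length_sub pos w ht.1 (ht.2.trans hc.2), walkCurve_length_sub pos w hc.1 hc.2]
  exact ⟨fun h => h.congr dist_eq, fun h => h.congr fun t ht => (dist_eq t ht).symm⟩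

end WalkCurve

/-! ### Conflicting edges -/

/-- Two points `x`, `y` lie on a common closed side of the strip bounded by the normals of the
segment `u v` at its endpoints: both beyond `v`, or both beyond `u`. -/
def SameSide (u v x y : Plane) : Prop :=
  (0 ≤ inner ℝ (x - v) (v - u) ∧ 0 ≤ inner ℝ (y - v) (v - u)) ∨
    (0 ≤ inner ℝ (x - u) (u - v) ∧ 0 ≤ inner ℝ (y - u) (u - v))

theorem SameSide.swap_left {u v x y : Plane} (h : SameSide u v x y) : SameSide v u x y :=
  Or.symm h

theorem SameSide.swap_right {u v x y : Plane} (h : SameSide u v x y) : SameSide u v y x :=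
  h.imp And.symm And.symm

section Conflicts

variable {V : Type*} {pos : V → Plane}

/-- The edge `e` keeps the distinct edge `f` out of every increasing-chord subtree that contains
`e`: the endpoints of `f` do not lie on a common side of the strip of `e`. The relation is not
symmetric. -/
def Conflicts (pos : V → Plane) (e f : Sym2 V) : Prop :=
  ∃ u v x y, s(u, v) = e ∧ s(x, y) = f ∧ e ≠ f ∧ ¬SameSide (pos u) (pos v) (pos x) (pos y)

theorem conflicts_mk_iff {u v x y : V} : Conflicts pos s(u, v) s(x, y) ↔
    s(u, v) ≠ s(x, y) ∧ ¬SameSide (pos u) (pos v) (pos x) (pos y) := by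
  refine ⟨?_, fun h => ⟨u, v, x, y, rfl, rfl, h⟩⟩
  rintro ⟨u', v', x', y', he, hf, hne, h⟩
  refine ⟨hne, fun h' => h ?_⟩
  rcases Sym2.eq_iff.1 he with ⟨rfl, rfl⟩ | ⟨rfl, rfl⟩ <;>
    rcases Sym2.eq_iff.1 hf with ⟨rfl, rfl⟩ | ⟨rfl, rfl⟩
  exacts [h', h'.swap_right, h'.swap_left, h'.swap_left.swap_right]

variable {H : SimpleGraph V}

theorem isSelfApproaching_of_not_conflicts (hpos : Function.Injective pos)
    (hH : ∀ e ∈ H.edgeSet, ∀ f ∈ H.edgeSet, ¬Conflicts pos e f) {u v : V} {w : H.Walk u v}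
    (hw : w.IsPath) : IsSelfApproaching (walkCurve pos w) w.length := by
  rw [walkCurve_eq_polyline]
  refine isSelfApproaching_polyline fun i hi j hj => ?_
  induction j, hj using Nat.le_induction with
  | base => simp
  | succ j hj ih =>
    rcases le_or_gt w.length j with hjL | hjL
    · have hstay : w.getVert (j + 1) = w.getVert j := by
        rw [w.getVert_of_length_le hjL, w.getVert_of_length_le (by omega)]
      rwa [hstay]
    have hadj := w.adj_getVert_succ hi
    have hinj := hw.getVert_injOn
    have hne : s(w.getVert i, w.getVert (i + 1)) ≠ s(w.getVert j, w.getVert (j + 1)) := by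
      intro he
      rcases Sym2.eq_iff.1 he with ⟨h, _⟩ | ⟨h, _⟩
      · have := hinj (show i ≤ w.length by omega) (show j ≤ w.length by omega) h
        omega
      · have := hinj (show i ≤ w.length by omega) (show j + 1 ≤ w.length by omega) h
        omega
    have hside := not_not.1 fun h => hH _ hadj _ (w.adj_getVert_succ hjL)
      (conflicts_mk_iff.2 ⟨hne, h⟩)
    refine hside.elim And.right fun h => absurd h.1 (not_le.2 ?_)
    have hpd := real_inner_self_pos.2 (sub_ne_zero.2 (hpos.ne hadj.ne'))
    rw [← neg_sub (pos (w.getVert (i + 1))), inner_neg_right,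
      ← sub_add_sub_cancel _ (pos (w.getVert (i + 1))), inner_add_left]
    linarith

theorem isIncreasingChordDrawing_of_not_conflicts (hpos : Function.Injective pos)
    (hconn : H.Connected) (hH : ∀ e ∈ H.edgeSet, ∀ f ∈ H.edgeSet, ¬Conflicts pos e f) :
    IsIncreasingChordDrawing H pos := by
  intro u v
  obtain ⟨w, hw⟩ := (hconn.preconnected u v).exists_isPath
  exact ⟨w, hw, (isIncreasingChordCurve_walkCurve_iff pos w).2
    ⟨isSelfApproaching_of_not_conflicts hpos hH hw,
      isSelfApproaching_of_not_conflicts hpos hH hw.reverse⟩⟩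

theorem IsIncreasingChordDrawing.inner_nonneg (hI : IsIncreasingChordDrawing H pos)
    (hH : H.IsAcyclic) {u v w : V} (huv : H.Adj u v)
    (hw : (H.deleteEdges {s(u, v)}).Reachable v w) :
    0 ≤ inner ℝ (pos w - pos v) (pos v - pos u) := by
  classical
  obtain ⟨p, hp⟩ := hw.exists_isPath
  have hu : u ∉ p.support := fun hu =>
    isBridge_iff.1 (isAcyclic_iff_forall_adj_isBridge.1 hH huv) (p.takeUntil u hu).reachable.symm
  have hpath : (Walk.cons huv (p.mapLe (deleteEdges_le _))).IsPath :=
    (Walk.cons_isPath_iff ..).2 ⟨hp.mapLe _, by simpa using hu⟩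
  obtain ⟨π, hπ, hchord⟩ := hI u w
  obtain rfl : π = Walk.cons huv (p.mapLe (deleteEdges_le _)) :=
    congrArg Subtype.val ((hH.subsingleton_path u w).elim ⟨π, hπ⟩ ⟨_, hpath⟩)
  have h := ((isIncreasingChordCurve_walkCurve_iff pos _).1 hchord).1
  rw [walkCurve_eq_polyline] at h
  simpa using inner_nonneg_of_isSelfApproaching_polyline (by simp) h

theorem reachable_deleteEdges_or (hconn : H.Connected) (u v x : V) :
    (H.deleteEdges {s(u, v)}).Reachable v x ∨ (H.deleteEdges {s(u, v)}).Reachable u x := by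
  have hvx := (reachable_iff_reflTransGen v x).1 (hconn.preconnected v x)
  induction hvx with
  | refl => exact Or.inl (Reachable.refl v)
  | @tail a b _ hab ih =>
    by_cases h : s(a, b) = s(u, v)
    · rcases Sym2.eq_iff.1 h with ⟨_, rfl⟩ | ⟨_, rfl⟩
      exacts [Or.inl (Reachable.refl _), Or.inr (Reachable.refl _)]
    · have hab' : (H.deleteEdges {s(u, v)}).Adj a b := deleteEdges_adj.2 ⟨hab, h⟩
      exact ih.imp (·.trans hab'.reachable) (·.trans hab'.reachable)

theorem IsIncreasingChordDrawing.not_conflicts (hI : IsIncreasingChordDrawing H pos)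
    (hH : H.IsTree) {e f : Sym2 V} (he : e ∈ H.edgeSet) (hf : f ∈ H.edgeSet) :
    ¬Conflicts pos e f := by
  rintro ⟨u, v, x, y, rfl, rfl, hne, h⟩
  have beyond {a b : V} (hab : s(a, b) = s(u, v)) (hbx : (H.deleteEdges {s(a, b)}).Reachable b x) :
      0 ≤ inner ℝ (pos x - pos b) (pos b - pos a) ∧
        0 ≤ inner ℝ (pos y - pos b) (pos b - pos a) := by
    have hadj : H.Adj a b := by rwa [← mem_edgeSet, hab]
    have hxy : (H.deleteEdges {s(a, b)}).Adj x y :=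
      deleteEdges_adj.2 ⟨hf, fun h => hne (hab ▸ h).symm⟩
    exact ⟨hI.inner_nonneg hH.isAcyclic hadj hbx,
      hI.inner_nonneg hH.isAcyclic hadj (hbx.trans hxy.reachable)⟩
  refine h ((reachable_deleteEdges_or hH.connected u v x).imp (beyond rfl) fun hux => ?_)
  exact beyond Sym2.eq_swap (by rwa [Sym2.eq_swap])

theorem conflicts_map_val_iff {S : Set V} (e f : Sym2 S) :
    Conflicts pos (e.map (↑)) (f.map (↑)) ↔ Conflicts (fun v : S => pos v) e f := by
  induction e with | _ u v
  induction f with | _ x y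
  simp only [Sym2.map_mk, conflicts_mk_iff, ne_eq, Sym2.eq_iff, Subtype.ext_iff]

theorem image_edgeSet_partGraph {F : Finset (Sym2 V)} (hF : ∀ e ∈ F, ¬e.IsDiag) :
    Sym2.map (↑) '' (partGraph F).edgeSet = (F : Set (Sym2 V)) := by
  ext e
  constructor
  · rintro ⟨e', he', rfl⟩
    induction e' with | _ u v
    exact he'.1
  · intro he
    induction e with | _ u v
    have huv : (fromEdgeSet (F : Set (Sym2 V))).Adj u v := (fromEdgeSet_adj _).2 ⟨he, hF _ he⟩
    exact ⟨s(⟨u, v, huv⟩, ⟨v, u, huv.symm⟩), huv, rfl⟩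

theorem isIncreasingChordSubtree_iff (hpos : Function.Injective pos) {F : Finset (Sym2 V)}
    (hF : ∀ e ∈ F, ¬e.IsDiag) : IsIncreasingChordSubtree pos F ↔
      (partGraph F).IsTree ∧ ∀ e ∈ F, ∀ f ∈ F, ¬Conflicts pos e f := by
  simp only [← Finset.mem_coe, ← image_edgeSet_partGraph hF, forall_mem_image,
    conflicts_map_val_iff]
  exact and_congr_right fun hT => ⟨fun hI e he f hf => hI.not_conflicts hT he hf,
    isIncreasingChordDrawing_of_not_conflicts (hpos.comp Subtype.val_injective) hT.connected⟩

end Conflicts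

end TreeDrawing

/-! ### Greedy multicuts in rooted trees -/

namespace TreeMulticut

open Finset

variable {p : ℕ → ℕ} {C C' : Finset ℕ} {z x a b : ℕ}

/-- The last node reached from `x` by moving to parents along uncut edges between nodes `≥ z`.

A rooted tree is given by its parent function `p` on natural numbers, with `p x < x` unless `x` is
the root, and a node stands also for the edge to its parent: `C` is the set of cut edges. Hence the
value at `z = 0` is the root of the component of `x` after all cuts, and larger `z` describe the
state of an algorithm that attaches the nodes to their parents from the largest parent down. -/
def top (p : ℕ → ℕ) (C : Finset ℕ) (z x : ℕ) : ℕ :=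
  if _ : p x < x ∧ x ∉ C ∧ z ≤ p x then top p C z (p x) else x

theorem top_parent (h : p x < x) (hC : x ∉ C) (hz : z ≤ p x) :
    top p C z (p x) = top p C z x := by
  conv_rhs => rw [top, dif_pos ⟨h, hC, hz⟩]

theorem top_eq_self (h : ¬(p x < x ∧ x ∉ C ∧ z ≤ p x)) : top p C z x = x := by
  rw [top, dif_neg h]

theorem top_of_mem (hx : x ∈ C) : top p C z x = x :=
  top_eq_self fun h => h.2.1 hx

theorem top_of_le (hx : x ≤ z) : top p C z x = x :=
  top_eq_self fun h => by omega

theorem top_induction {P : ℕ → Prop} (self : ∀ x, ¬(p x < x ∧ x ∉ C ∧ z ≤ p x) → P x)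
    (parent : ∀ x, p x < x → x ∉ C → z ≤ p x → P (p x) → P x) (x : ℕ) : P x := by
  induction x using Nat.strong_induction_on with
  | _ x ih =>
    by_cases h : p x < x ∧ x ∉ C ∧ z ≤ p x
    exacts [parent x h.1 h.2.1 h.2.2 (ih _ h.1), self x h]

theorem top_le : top p C z x ≤ x := by
  induction x using top_induction (p := p) (C := C) (z := z) with
  | self x h => exact (top_eq_self h).le
  | parent x h hC hz ih => exact top_parent h hC hz ▸ ih.trans h.le

theorem le_top (hx : z ≤ x) : z ≤ top p C z x := by
  induction x using top_induction (p := p) (C := C) (z := z) with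
  | self x h => rwa [top_eq_self h]
  | parent x h hC hz ih => exact top_parent h hC hz ▸ ih hz

theorem top_mem_or_parent_lt_or_le : top p C z x ∈ C ∨ p (top p C z x) < z ∨
    top p C z x ≤ p (top p C z x) := by
  induction x using top_induction (p := p) (C := C) (z := z) with
  | self x h =>
    rw [top_eq_self h]
    by_contra! h'
    exact h ⟨h'.2.2, h'.1, h'.2.1⟩
  | parent x h hC hz ih => rwa [← top_parent h hC hz]

theorem top_congr (h : ∀ x, z ≤ p x → (x ∈ C ↔ x ∈ C')) : top p C z x = top p C' z x := by
  induction x using top_induction (p := p) (C := C) (z := z) with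
  | self x hx =>
    rw [top_eq_self hx, top_eq_self fun hx' => hx ⟨hx'.1, (h x hx'.2.2).not.2 hx'.2.1, hx'.2.2⟩]
  | parent x hx hC hz ih => rwa [← top_parent hx hC hz, ← top_parent hx ((h x hz).not.1 hC) hz]

theorem top_eq_ite : top p C z x =
    if top p C (z + 1) x ∉ C ∧ p (top p C (z + 1) x) = z ∧ z < top p C (z + 1) x then z
    else top p C (z + 1) x := by
  induction x using top_induction (p := p) (C := C) (z := z + 1) with
  | self x hx =>
    rw [top_eq_self hx]
    split_ifs with h
    · rw [← top_parent (h.2.1.trans_lt h.2.2) h.1 h.2.1.ge, h.2.1, top_of_le le_rfl]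
    · exact top_eq_self fun h' => by grind
  | parent x hx hC hz ih => rwa [← top_parent hx hC (by omega), ← top_parent hx hC hz]

theorem top_eq_of_top_succ_mem (h : top p C (z + 1) x ∈ C) :
    top p C z x = top p C (z + 1) x := by
  rw [top_eq_ite, if_neg fun h' => h'.1 h]

theorem top_eq_iff : top p C z x = z ↔ top p C (z + 1) x = z ∨
    top p C (z + 1) x ∉ C ∧ p (top p C (z + 1) x) = z ∧ z < top p C (z + 1) x := by
  rw [top_eq_ite]
  split_ifs with h <;> simp [h]

theorem top_eq_top_succ (h : top p C z x ≠ z) : top p C z x = top p C (z + 1) x := by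
  rw [top_eq_ite] at h ⊢
  exact if_neg fun h' => h (if_pos h')

theorem top_succ_eq_iff : top p C (z + 1) x = z ↔ x = z := by
  refine ⟨fun h => ?_, fun h => h ▸ top_of_le (by omega)⟩
  have hx : x < z + 1 := lt_of_not_ge fun hx => by
    have := h ▸ le_top (p := p) (C := C) hx
    omega
  rwa [top_of_le hx.le] at h

theorem top_eq_of_top_eq_top (h : top p C z a = top p C z b)
    (h' : top p C (z + 1) a ≠ top p C (z + 1) b) : top p C z a = z := by
  rw [top_eq_ite, top_eq_ite (x := b)] at h
  rw [top_eq_ite]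
  grind

theorem top_eq_of_subset (hC : C ⊆ C') (h : top p C' z x = z) : top p C z x = z := by
  induction x using top_induction (p := p) (C := C') (z := z) with
  | self x hx =>
    rw [top_eq_self hx] at h
    exact h ▸ top_of_le le_rfl
  | parent x hx hC' hz ih =>
    rw [← top_parent hx (fun h => hC' (hC h)) hz]
    exact ih ((top_parent hx hC' hz).trans h)

theorem exists_ne_parent {γ : Type*} {M : ℕ → γ} (h : M x ≠ M (p (top p C z x))) :
    ∃ y ≤ x, top p C z y = top p C z x ∧ M y ≠ M (p y) := by
  induction x using top_induction (p := p) (C := C) (z := z) with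
  | self x hx => exact ⟨x, le_rfl, rfl, by rwa [top_eq_self hx] at h⟩
  | parent x hx hC hz ih =>
    by_cases hM : M x = M (p x)
    · rw [hM, ← top_parent hx hC hz] at h
      obtain ⟨y, hy, htop, hne⟩ := ih h
      exact ⟨y, hy.trans hx.le, htop.trans (top_parent hx hC hz), hne⟩
    · exact ⟨x, le_rfl, rfl, hM⟩

/-- The invariant of the greedy multicut algorithm on the nodes `0, …, N - 1`, for a relation `Conf`
that says which nodes must be separated. All cut edges have their upper end at `l` or below in the
tree, the conflicts are resolved among the nodes attached so far, those with parent `≥ z`, and the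
number of cuts is at most twice the number of colour changes of any proper colouring `M` in the
components that have been cut off. -/
structure GreedyInvariant (γ : Type*) [DecidableEq γ] (p : ℕ → ℕ) (N : ℕ) (Conf : ℕ → ℕ → Prop)
    (l z : ℕ) (C : Finset ℕ) : Prop where
  lt_of_mem : ∀ c ∈ C, c < N
  le_parent : ∀ c ∈ C, l ≤ p c
  parent_lt : ∀ c ∈ C, p c < c
  separated : ∀ a b, Conf a b → top p C z a ≠ top p C z b
  card_le : ∀ M : ℕ → γ, (∀ a b, Conf a b → M a ≠ M b) →
    #C ≤ 2 * #{x ∈ range N | M x ≠ M (p x) ∧ top p C z x ∈ C}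

namespace GreedyInvariant

variable {γ : Type*} [DecidableEq γ] {N : ℕ} {Conf : ℕ → ℕ → Prop}

theorem empty (hne : ∀ a b, Conf a b → a ≠ b) (hlt : ∀ a b, Conf a b → a < N ∧ b < N) :
    GreedyInvariant γ p N Conf N N ∅ where
  lt_of_mem := by simp
  le_parent := by simp
  parent_lt := by simp
  separated a b h := by
    rw [top_of_le (hlt a b h).1.le, top_of_le (hlt a b h).2.le]
    exact hne a b h
  card_le := by simp

theorem mono_left {l l' : ℕ} (h : GreedyInvariant γ p N Conf l z C) (hl : l' ≤ l) :
    GreedyInvariant γ p N Conf l' z C :=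
  { h with le_parent := fun c hc => hl.trans (h.le_parent c hc) }

theorem descend {l : ℕ} (h : GreedyInvariant γ p N Conf l (z + 1) C)
    (hsep : ∀ a b, Conf a b → top p C z a ≠ top p C z b) : GreedyInvariant γ p N Conf l z C where
  lt_of_mem := h.lt_of_mem
  le_parent := h.le_parent
  parent_lt := h.parent_lt
  separated := hsep
  card_le M hM := (h.card_le M hM).trans <| by
    gcongr with x
    exact fun hx => by rwa [top_eq_of_top_succ_mem hx]

end GreedyInvariant

/-- Cut the edges through which `a` and `b` are about to be joined at `z`. The node `z` is among
them only if it is `a` or `b`, and then nothing has to be cut on that side. -/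
def cut (p : ℕ → ℕ) (C : Finset ℕ) (z a b : ℕ) : Finset ℕ :=
  C ∪ ({top p C (z + 1) a, top p C (z + 1) b} : Finset ℕ).erase z

theorem mem_cut {c : ℕ} : c ∈ cut p C z a b ↔
    c ∈ C ∨ c ≠ z ∧ (c = top p C (z + 1) a ∨ c = top p C (z + 1) b) := by
  simp [cut]

theorem subset_cut : C ⊆ cut p C z a b :=
  subset_union_left

theorem mem_or_of_mem_cut (ha : top p C z a = z) (hb : top p C z b = z) {c : ℕ}
    (hc : c ∈ cut p C z a b) : c ∈ C ∨ p c = z ∧ z < c := by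
  rcases mem_cut.1 hc with hc | ⟨hne, rfl | rfl⟩
  · exact Or.inl hc
  · exact Or.inr ((top_eq_iff.1 ha).resolve_left hne).2
  · exact Or.inr ((top_eq_iff.1 hb).resolve_left hne).2

theorem top_succ_cut (ha : top p C z a = z) (hb : top p C z b = z) :
    top p (cut p C z a b) (z + 1) x = top p C (z + 1) x := by
  refine top_congr fun y hy => ⟨fun h => ?_, fun h => subset_cut h⟩
  exact (mem_or_of_mem_cut ha hb h).resolve_right fun h' => by omega

theorem top_cut_ne (ha : top p C z a = z) (hb : top p C z b = z) (hne : a ≠ b) :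
    top p (cut p C z a b) z a ≠ z ∨ top p (cut p C z a b) z b ≠ z := by
  by_contra! h
  rw [top_eq_iff, top_eq_iff, top_succ_cut ha hb, top_succ_cut ha hb, mem_cut, mem_cut,
    top_succ_eq_iff, top_succ_eq_iff] at h
  grind

/-- A colour change on the way from `a` up to `z` pays for cutting the last edge of that way. -/
theorem exists_ne_parent_of_top_eq {γ : Type*} {M : ℕ → γ} (ha : top p C z a = z)
    (hM : M a ≠ M z) : ∃ y ≤ a, M y ≠ M (p y) ∧ top p C (z + 1) y = top p C (z + 1) a ∧
      top p C (z + 1) a ≠ z ∧ top p C (z + 1) a ∉ C := by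
  have hne : top p C (z + 1) a ≠ z := fun h => hM (by rw [top_succ_eq_iff.1 h])
  obtain ⟨hC, hp, -⟩ := (top_eq_iff.1 ha).resolve_left hne
  obtain ⟨y, hy, htop, hMy⟩ := exists_ne_parent (p := p) (C := C) (z := z + 1) (hp ▸ hM)
  exact ⟨y, hy, hMy, htop, hne, hC⟩

namespace GreedyInvariant

variable {γ : Type*} [DecidableEq γ] {N l : ℕ} {Conf : ℕ → ℕ → Prop}

theorem card_cut_le (h : GreedyInvariant γ p N Conf l (z + 1) C) (hab : Conf a b) (haN : a < N)
    (hbN : b < N) (ha : top p C z a = z) (hb : top p C z b = z) (M : ℕ → γ)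
    (hM : ∀ a b, Conf a b → M a ≠ M b) : #(cut p C z a b) ≤
      2 * #{x ∈ range N | M x ≠ M (p x) ∧ top p C (z + 1) x ∈ cut p C z a b} := by
  obtain ⟨y, hyN, hMy, hy, hyC⟩ : ∃ y < N, M y ≠ M (p y) ∧
      top p C (z + 1) y ∈ cut p C z a b ∧ top p C (z + 1) y ∉ C := by
    have pays {c : ℕ} (hc : c < N) (hcz : top p C z c = z) (hcab : c = a ∨ c = b)
        (hMc : M c ≠ M z) : ∃ y < N, M y ≠ M (p y) ∧
          top p C (z + 1) y ∈ cut p C z a b ∧ top p C (z + 1) y ∉ C := by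
      obtain ⟨y, hy, hMy, htop, hne, hC⟩ := exists_ne_parent_of_top_eq hcz hMc
      rw [← htop] at hne hC
      exact ⟨y, hy.trans_lt hc, hMy, mem_cut.2 (Or.inr ⟨hne, by grind⟩), hC⟩
    by_cases hMa : M a = M z
    · exact pays hbN hb (Or.inr rfl) fun hMb => hM a b hab (hMa.trans hMb.symm)
    · exact pays haN ha (Or.inl rfl) hMa
  have hcut : #(cut p C z a b) ≤ #C + 2 :=
    (card_union_le _ _).trans (by gcongr; exact (card_erase_le).trans card_le_two)
  have hcharged : #{x ∈ range N | M x ≠ M (p x) ∧ top p C (z + 1) x ∈ C} + 1 ≤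
      #{x ∈ range N | M x ≠ M (p x) ∧ top p C (z + 1) x ∈ cut p C z a b} := by
    refine card_lt_card ⟨fun x => ?_, fun hsub => ?_⟩
    · simp only [mem_filter]
      exact fun hx => ⟨hx.1, hx.2.1, subset_cut hx.2.2⟩
    · exact hyC (mem_filter.1 (hsub (mem_filter.2 ⟨mem_range.2 hyN, hMy, hy⟩))).2.2
  have := h.card_le M hM
  omega

theorem cut (h : GreedyInvariant γ p N Conf z (z + 1) C) (hab : Conf a b) (haN : a < N)
    (hbN : b < N) (ha : top p C z a = z) (hb : top p C z b = z) :
    GreedyInvariant γ p N Conf z (z + 1) (cut p C z a b) where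
  lt_of_mem c hc := by
    rcases mem_cut.1 hc with hc | ⟨-, rfl | rfl⟩
    exacts [h.lt_of_mem c hc, top_le.trans_lt haN, top_le.trans_lt hbN]
  le_parent c hc := (mem_or_of_mem_cut ha hb hc).elim (h.le_parent c) fun h => h.1.ge
  parent_lt c hc := (mem_or_of_mem_cut ha hb hc).elim (h.parent_lt c) fun h => h.1.trans_lt h.2
  separated a' b' hab' := by
    rw [top_succ_cut ha hb, top_succ_cut ha hb]
    exact h.separated a' b' hab'
  card_le M hM := by
    simp only [top_succ_cut ha hb]
    exact h.card_cut_le hab haN hbN ha hb M hM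

end GreedyInvariant

end TreeMulticut

/-! ### Rooted trees as parent functions -/

namespace TreeDrawing

open Finset SimpleGraph TreeMulticut

variable {V : Type*} {G : SimpleGraph V}

/-- A rooting of a tree `G` with `m` edges, encoded on the natural numbers `0, …, 2 * m` as the
subdivision of `G`: the even numbers stand for the vertices, `0` for the root, the odd numbers for
the edges, and `p` is the parent function. An edge `uv` with `u` closer to the root has the parent
`u` and is the parent of `v`; the numbers of the edge and of `v` are consecutive. -/
structure IsRooting (G : SimpleGraph V) (m : ℕ) (p : ℕ → ℕ) (node : V → ℕ)
    (enode : Sym2 V → ℕ) : Prop where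
  node_bijOn : Set.BijOn node Set.univ {x | x ≤ 2 * m ∧ Even x}
  enode_bijOn : Set.BijOn enode G.edgeSet {x | x < 2 * m ∧ Odd x}
  parent_zero : p 0 = 0
  parent_lt : ∀ x, 0 < x → p x < x
  exists_eq_mk : ∀ e ∈ G.edgeSet, ∃ u v, e = s(u, v) ∧ p (enode e) = node u ∧
    node v = enode e + 1 ∧ p (node v) = enode e

/-- The vertex for which a node of a rooted tree stands, or its upper end if it is an edge. -/
def upperEnd (p : ℕ → ℕ) (x : ℕ) : ℕ :=
  if Even x then x else p x

namespace IsRooting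

variable {m : ℕ} {p : ℕ → ℕ} {node : V → ℕ} {enode : Sym2 V → ℕ}
  {C : Finset ℕ} {t x : ℕ} {u v w : V}

theorem node_injective (hR : IsRooting G m p node enode) : Function.Injective node :=
  Set.injOn_univ.1 hR.node_bijOn.injOn

theorem node_le (hR : IsRooting G m p node enode) (v : V) : node v ≤ 2 * m :=
  (hR.node_bijOn.mapsTo (Set.mem_univ v)).1

theorem even_node (hR : IsRooting G m p node enode) (v : V) : Even (node v) :=
  (hR.node_bijOn.mapsTo (Set.mem_univ v)).2

theorem enode_lt (hR : IsRooting G m p node enode) {e : Sym2 V} (he : e ∈ G.edgeSet) :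
    enode e < 2 * m :=
  (hR.enode_bijOn.mapsTo he).1

theorem odd_enode (hR : IsRooting G m p node enode) {e : Sym2 V} (he : e ∈ G.edgeSet) :
    Odd (enode e) :=
  (hR.enode_bijOn.mapsTo he).2

theorem upperEnd_node (hR : IsRooting G m p node enode) (v : V) :
    upperEnd p (node v) = node v :=
  if_pos (hR.even_node v)

theorem upperEnd_enode (hR : IsRooting G m p node enode) {e : Sym2 V} (he : e ∈ G.edgeSet) :
    upperEnd p (enode e) = p (enode e) :=
  if_neg (Nat.not_even_iff_odd.2 (hR.odd_enode he))

theorem parent_enode_or (hR : IsRooting G m p node enode) (h : s(v, w) ∈ G.edgeSet) :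
    p (enode s(v, w)) = node v ∨
      p (enode s(v, w)) = node w ∧ node v = enode s(v, w) + 1 ∧ p (node v) = enode s(v, w) := by
  obtain ⟨a, b, hab, ha, hb, hpb⟩ := hR.exists_eq_mk _ h
  rcases Sym2.eq_iff.1 hab with ⟨rfl, rfl⟩ | ⟨rfl, rfl⟩
  exacts [Or.inl ha, Or.inr ⟨ha, hb, hpb⟩]

theorem exists_eq_node (hR : IsRooting G m p node enode) (hx : x ≤ 2 * m) (hx' : Even x) :
    ∃ v, node v = x :=
  (hR.node_bijOn.surjOn ⟨hx, hx'⟩).imp fun _ h => h.2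

theorem exists_eq_enode (hR : IsRooting G m p node enode) (hx : x < 2 * m) (hx' : Odd x) :
    ∃ u v, s(u, v) ∈ G.edgeSet ∧ enode s(u, v) = x ∧ p x = node u ∧ node v = x + 1 ∧
      p (x + 1) = x := by
  obtain ⟨e, he, rfl⟩ := hR.enode_bijOn.surjOn ⟨hx, hx'⟩
  obtain ⟨u, v, rfl, hu, hv, hpv⟩ := hR.exists_eq_mk e he
  exact ⟨u, v, he, rfl, hu, hv, hv ▸ hpv⟩

theorem exists_node_eq_upperEnd (hR : IsRooting G m p node enode) (hx : x ≤ 2 * m) :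
    ∃ v, node v = upperEnd p x := by
  rcases Nat.even_or_odd x with hx' | hx'
  · exact (hR.exists_eq_node hx hx').imp fun v hv => by rw [← hv, hR.upperEnd_node]
  · obtain ⟨u, v, huv, rfl, hu, -⟩ := hR.exists_eq_enode (by grind) hx'
    exact ⟨u, by rw [hR.upperEnd_enode huv, hu]⟩

theorem exists_adj_of_lt (hR : IsRooting G m p node enode) (h : 0 < node v) :
    ∃ u, s(u, v) ∈ G.edgeSet ∧ p (node v) = enode s(u, v) ∧ p (enode s(u, v)) = node u := by
  have hv := hR.node_le v
  obtain ⟨u, w, huw, hx, hu, hw, hpw⟩ := hR.exists_eq_enode (x := node v - 1) (by omega)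
    (by have := hR.even_node v; grind)
  obtain rfl : w = v := hR.node_injective (by omega)
  exact ⟨u, huw, by rw [hw, hpw, hx], hx ▸ hu⟩

theorem reachable_of_top_eq (hR : IsRooting G m p node enode) {H : SimpleGraph V}
    (hH : ∀ u v, s(u, v) ∈ G.edgeSet → top p C 0 (enode s(u, v)) = t → H.Adj u v)
    (hx : x ≤ 2 * m) (ht : top p C 0 x = t) (hu : node u = upperEnd p x)
    (hw : node w = upperEnd p t) : H.Reachable u w := by
  induction x using top_induction (p := p) (C := C) (z := 0) generalizing u with
  | self x h =>
    rw [top_eq_self h] at ht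
    rw [hR.node_injective (hu.trans (ht ▸ hw.symm))]
  | parent x h hC hz ih =>
    rw [← top_parent h hC hz] at ht
    rcases Nat.even_or_odd x with hx' | hx'
    · rw [upperEnd, if_pos hx'] at hu
      obtain ⟨u', he, hpu, hpe⟩ := hR.exists_adj_of_lt (v := u) (by omega)
      rw [hu] at hpu
      have hadj : H.Adj u' u := hH u' u he (hpu ▸ ht)
      refine hadj.symm.reachable.trans (ih (by omega) ht ?_)
      rw [hpu, hR.upperEnd_enode he, hpe]
    · obtain ⟨u', v, he, rfl, hpe, -⟩ := hR.exists_eq_enode (by grind) hx'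
      rw [hR.upperEnd_enode he] at hu
      exact ih (by omega) ht (by rw [hu, hpe, hR.upperEnd_node])

end IsRooting

/-! ### The partition defined by a cut -/

section Fibres

variable [Fintype G.edgeSet]

theorem fromEdgeSet_adj_iff {F : Finset (Sym2 V)} (hF : F ⊆ G.edgeFinset) {a b : V} :
    (fromEdgeSet (F : Set (Sym2 V))).Adj a b ↔ s(a, b) ∈ F := by
  rw [fromEdgeSet_adj, mem_coe]
  exact and_iff_left_of_imp fun h => (mem_edgeFinset.1 (hF h) : G.Adj a b).ne

theorem not_isDiag_of_subset {F : Finset (Sym2 V)} (hF : F ⊆ G.edgeFinset) :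
    ∀ e ∈ F, ¬e.IsDiag :=
  fun _ he => G.not_isDiag_of_mem_edgeSet (mem_edgeFinset.1 (hF he))

omit [Fintype G.edgeSet] in
theorem reachable_induce_support {a b : V} (w : G.Walk a b) (ha : a ∈ G.support)
    (hb : b ∈ G.support) : (G.induce G.support).Reachable ⟨a, ha⟩ ⟨b, hb⟩ := by
  induction w with
  | nil => exact Reachable.refl _
  | @cons a c b h _ ih =>
    have hc : c ∈ G.support := ⟨a, h.symm⟩
    have hac : (G.induce G.support).Adj ⟨a, ha⟩ ⟨c, hc⟩ := h
    exact hac.reachable.trans (ih hc hb)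

theorem isTree_partGraph (hG : G.IsAcyclic) {F : Finset (Sym2 V)} (hF : F ⊆ G.edgeFinset)
    (hne : F.Nonempty) {w : V}
    (hw : ∀ u v, s(u, v) ∈ F → (fromEdgeSet (F : Set (Sym2 V))).Reachable u w) :
    (partGraph F).IsTree := by
  have hle : fromEdgeSet (F : Set (Sym2 V)) ≤ G := fun a b hab =>
    mem_edgeFinset.1 (hF ((fromEdgeSet_adj_iff hF).1 hab))
  have hnonempty : Nonempty (partVerts F) := by
    obtain ⟨e, he⟩ := hne
    induction e with | _ u v
    exact ⟨u, v, (fromEdgeSet_adj_iff hF).2 he⟩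
  have hreach (v : partVerts F) : (fromEdgeSet (F : Set (Sym2 V))).Reachable v w :=
    v.2.elim fun u hu => hw v u ((fromEdgeSet_adj_iff hF).1 hu)
  refine ⟨⟨fun a b => ?_⟩, (hG.anti hle).induce _⟩
  obtain ⟨q⟩ := (hreach a).trans (hreach b).symm
  exact reachable_induce_support q a.2 b.2

namespace IsRooting

variable {m : ℕ} {p : ℕ → ℕ} {node : V → ℕ} {enode : Sym2 V → ℕ} {C : Finset ℕ} {t : ℕ} {v : V}

theorem isTree_partGraph_filter (hG : G.IsAcyclic) (hR : IsRooting G m p node enode)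
    (hne : {e ∈ G.edgeFinset | top p C 0 (enode e) = t}.Nonempty) :
    (partGraph {e ∈ G.edgeFinset | top p C 0 (enode e) = t}).IsTree := by
  set F := {e ∈ G.edgeFinset | top p C 0 (enode e) = t} with hF
  have hFG : F ⊆ G.edgeFinset := filter_subset _ _
  have hmem {e : Sym2 V} : e ∈ F ↔ e ∈ G.edgeSet ∧ top p C 0 (enode e) = t := by
    rw [hF, mem_filter, mem_edgeFinset]
  obtain ⟨w, hw⟩ : ∃ w, node w = upperEnd p t := by
    obtain ⟨e, heF⟩ := hne
    obtain ⟨he, ht⟩ := hmem.1 heF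
    exact hR.exists_node_eq_upperEnd (ht ▸ top_le.trans (hR.enode_lt he).le)
  have hH (a b : V) (h : s(a, b) ∈ G.edgeSet) (ht : top p C 0 (enode s(a, b)) = t) :
      (fromEdgeSet (F : Set (Sym2 V))).Adj a b :=
    (fromEdgeSet_adj_iff hFG).2 (hmem.2 ⟨h, ht⟩)
  refine isTree_partGraph hG hFG hne (w := w) fun u v huv => ?_
  have ⟨he, ht⟩ := hmem.1 huv
  have hupper (a : V) (ha : p (enode s(u, v)) = node a) :
      (fromEdgeSet (F : Set (Sym2 V))).Reachable a w :=
    hR.reachable_of_top_eq hH (hR.enode_lt he).le ht (by rw [hR.upperEnd_enode he, ha]) hw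
  rcases hR.parent_enode_or he with h | ⟨h, -⟩
  · exact hupper u h
  · exact (hH u v he ht).reachable.trans (hupper v h)

theorem isLeafOf_filter (hR : IsRooting G m p node enode) (ht : t ≠ top p C 0 (node v))
    (hv : v ∈ partVerts {e ∈ G.edgeFinset | top p C 0 (enode e) = t}) :
    IsLeafOf {e ∈ G.edgeFinset | top p C 0 (enode e) = t} v := by
  set F := {e ∈ G.edgeFinset | top p C 0 (enode e) = t}
  have hFG : F ⊆ G.edgeFinset := filter_subset _ _
  have henode (w : V) (hw : s(v, w) ∈ F) : s(v, w) ∈ G.edgeSet ∧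
      (node v < t ∧ enode s(v, w) = t ∨ node v = enode s(v, w) + 1 ∧ t ≤ enode s(v, w)) := by
    obtain ⟨he, hwt⟩ := mem_filter.1 hw
    rw [mem_edgeFinset] at he
    refine ⟨he, (hR.parent_enode_or he).imp (fun h => ?_) fun h => ⟨h.2.1, hwt ▸ top_le⟩⟩
    have hlt := hR.parent_lt _ (hR.odd_enode he).pos
    by_cases hC : enode s(v, w) ∈ C
    · rw [top_of_mem hC] at hwt
      exact ⟨h ▸ hwt ▸ hlt, hwt⟩
    · rw [← top_parent hlt hC (Nat.zero_le _), h] at hwt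
      exact absurd hwt.symm ht
  obtain ⟨w, hw⟩ := hv
  rw [IsLeafOf, Set.ncard_eq_one]
  refine ⟨w, Set.eq_singleton_iff_unique_mem.2 ⟨hw, fun w' hw' => ?_⟩⟩
  obtain ⟨he, h⟩ := henode w ((fromEdgeSet_adj_iff hFG).1 hw)
  obtain ⟨he', h'⟩ := henode w' ((fromEdgeSet_adj_iff hFG).1 hw')
  exact Sym2.congr_right.1 (hR.enode_bijOn.injOn he' he (by omega))

end IsRooting

variable [DecidableEq V]

/-- The partition of the edges into the fibres of a function. -/
def fibrePartition (E : Finset (Sym2 V)) (ℓ : Sym2 V → ℕ) : Finpartition E :=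
  haveI : DecidableRel (Setoid.ker ℓ) := fun e f => decEq (ℓ e) (ℓ f)
  Finpartition.ofSetSetoid (Setoid.ker ℓ) E

theorem mem_parts_fibrePartition {E F : Finset (Sym2 V)} {ℓ : Sym2 V → ℕ} :
    F ∈ (fibrePartition E ℓ).parts ↔ ∃ e ∈ E, {f ∈ E | ℓ f = ℓ e} = F := by
  simp only [fibrePartition, Finpartition.ofSetSetoid_parts, mem_image, Setoid.ker_def, eq_comm]

theorem exists_mem_parts_fibrePartition_iff {E : Finset (Sym2 V)} {ℓ : Sym2 V → ℕ}
    {e f : Sym2 V} (he : e ∈ E) (hf : f ∈ E) :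
    (∃ F ∈ (fibrePartition E ℓ).parts, e ∈ F ∧ f ∈ F) ↔ ℓ e = ℓ f := by
  simp only [mem_parts_fibrePartition]
  grind

theorem card_parts_fibrePartition_le (E : Finset (Sym2 V)) (ℓ : Sym2 V → ℕ) :
    #(fibrePartition E ℓ).parts ≤ #(E.image ℓ) := by
  refine (card_le_card fun F hF => ?_).trans
    (card_image_le (f := fun t => {f ∈ E | ℓ f = t}))
  obtain ⟨e, he, rfl⟩ := mem_parts_fibrePartition.1 hF
  exact mem_image_of_mem _ (mem_image_of_mem _ he)

namespace IsRooting

variable {m : ℕ} {p : ℕ → ℕ} {node : V → ℕ} {enode : Sym2 V → ℕ} {C : Finset ℕ}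

theorem card_parts_le (hR : IsRooting G m p node enode) :
    #(fibrePartition G.edgeFinset fun e => top p C 0 (enode e)).parts ≤ #C + 1 := by
  refine (card_parts_fibrePartition_le _ _).trans
    ((card_le_card fun t ht => ?_).trans (card_insert_le 0 C))
  obtain ⟨e, -, rfl⟩ := mem_image.1 ht
  have h := top_mem_or_parent_lt_or_le (p := p) (C := C) (z := 0) (x := enode e)
  have h' := hR.parent_lt (top p C 0 (enode e))
  rw [mem_insert, or_iff_not_imp_left]
  exact fun h0 => h.resolve_right (by have := h' (Nat.pos_of_ne_zero h0); omega)

theorem isProperDecomposition {pos : V → Plane} (hpos : Function.Injective pos)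
    (hG : G.IsAcyclic) (hR : IsRooting G m p node enode)
    (hC : ∀ e ∈ G.edgeSet, ∀ f ∈ G.edgeSet, Conflicts pos e f →
      top p C 0 (enode e) ≠ top p C 0 (enode f)) :
    IsProperDecomposition pos
      (fibrePartition G.edgeFinset fun e => top p C 0 (enode e)) := by
  constructor
  · intro F hF
    have hFG := (fibrePartition _ _).le hF
    have hne := (fibrePartition _ _).nonempty_of_mem_parts hF
    obtain ⟨e₀, -, rfl⟩ := mem_parts_fibrePartition.1 hF
    refine (isIncreasingChordSubtree_iff hpos (not_isDiag_of_subset hFG)).2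
      ⟨hR.isTree_partGraph_filter hG hne, fun e he f hf hef => ?_⟩
    rw [mem_filter, mem_edgeFinset] at he hf
    exact hC e he.1 f hf.1 hef (he.2.trans hf.2.symm)
  · intro F₁ hF₁ F₂ hF₂ hne v hv₁ hv₂
    obtain ⟨e₁, -, rfl⟩ := mem_parts_fibrePartition.1 hF₁
    obtain ⟨e₂, -, rfl⟩ := mem_parts_fibrePartition.1 hF₂
    by_cases h : top p C 0 (enode e₁) = top p C 0 (node v)
    · exact Or.inr (hR.isLeafOf_filter (fun h' => hne (by rw [h, h'])) hv₂)
    · exact Or.inl (hR.isLeafOf_filter h hv₁)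

end IsRooting

end Fibres

end TreeDrawing

/-! ### The lower bound -/

namespace TreeDrawing

open Finset SimpleGraph TreeMulticut

variable {V : Type*} {G : SimpleGraph V} [Fintype G.edgeSet] {pos : V → Plane}

theorem ncard_partVerts [Finite V] {F : Finset (Sym2 V)} (hF : F ⊆ G.edgeFinset)
    (hT : (partGraph F).IsTree) : (partVerts F).ncard = #F + 1 := by
  classical
  have := Fintype.ofFinite V
  have hedge : (fromEdgeSet (F : Set (Sym2 V))).edgeFinset = F := by
    ext e
    induction e with | _ a b
    rw [mem_edgeFinset, mem_edgeSet, fromEdgeSet_adj_iff hF]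
  have hcard : #(partGraph F).edgeFinset = #F :=
    (by convert card_edgeFinset_induce_support : _ = _).trans (congrArg card hedge)
  rw [← Nat.card_coe_set_eq, Nat.card_eq_fintype_card, ← hT.card_edgeFinset, hcard]

section Partition

variable [DecidableEq V] {P : Finpartition G.edgeFinset}

theorem sum_ncard_partVerts [Fintype V] (hG : G.IsTree) (hP : ∀ F ∈ P.parts, (partGraph F).IsTree) :
    ∑ F ∈ P.parts, (partVerts F).ncard + 1 = Fintype.card V + #P.parts := by
  rw [sum_congr rfl fun F hF => ncard_partVerts (P.le hF) (hP F hF), sum_add_distrib,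
    P.sum_card_parts, sum_const, smul_eq_mul, mul_one, ← hG.card_edgeFinset]
  ring

open Classical in
theorem sum_card_ne_main [Fintype V] (hG : G.IsTree) (hP : ∀ F ∈ P.parts, (partGraph F).IsTree)
    {main : V → Finset (Sym2 V)} (hmain : ∀ v, main v ∈ P.parts)
    (hmem : ∀ v, v ∈ partVerts (main v)) :
    ∑ v, #{F ∈ P.parts | v ∈ partVerts F ∧ F ≠ main v} + 1 = #P.parts := by
  have hsum : ∑ F ∈ P.parts, (partVerts F).ncard = ∑ v, #{F ∈ P.parts | v ∈ partVerts F} := by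
    simp_rw [card_filter, sum_comm (s := univ), ← card_filter, ← Set.ncard_coe_finset,
      coe_filter_univ, Set.ofPred_mem_eq]
  have herase (v : V) : #{F ∈ P.parts | v ∈ partVerts F ∧ F ≠ main v} + 1 =
      #{F ∈ P.parts | v ∈ partVerts F} := by
    have hv : main v ∈ {F ∈ P.parts | v ∈ partVerts F} := mem_filter.2 ⟨hmain v, hmem v⟩
    rw [← card_erase_add_one hv, ← filter_ne', filter_filter]
  have := sum_ncard_partVerts hG hP
  simp_rw [hsum, ← herase, sum_add_distrib, sum_const, smul_eq_mul, mul_one, card_univ] at this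
  omega

theorem eq_of_part_eq_of_isLeafOf {v : V} {e f : Sym2 V} (he : e ∈ G.edgeFinset)
    (hf : f ∈ G.edgeFinset) (hve : v ∈ e) (hvf : v ∈ f) (hef : P.part e = P.part f)
    (hleaf : IsLeafOf (P.part e) v) : e = f := by
  obtain ⟨w, rfl⟩ := hve
  obtain ⟨w', rfl⟩ := hvf
  have hsub := P.le (P.part_mem.2 he)
  obtain ⟨u, hu⟩ := Set.ncard_eq_one.1 hleaf
  have hw : w ∈ ({u} : Set V) := hu ▸ (fromEdgeSet_adj_iff hsub).2 (P.mem_part he)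
  have hw' : w' ∈ ({u} : Set V) := hu ▸ (fromEdgeSet_adj_iff hsub).2 (hef ▸ P.mem_part hf)
  rw [hw, hw']

namespace IsProperDecomposition

theorem exists_main [Nontrivial V] (hP : IsProperDecomposition pos P) (hG : G.Preconnected)
    (v : V) : ∃ F ∈ P.parts, v ∈ partVerts F ∧
      ∀ F' ∈ P.parts, v ∈ partVerts F' → F' ≠ F → IsLeafOf F' v := by
  by_cases h : ∃ F ∈ P.parts, v ∈ partVerts F ∧ ¬IsLeafOf F v
  · obtain ⟨F, hF, hv, hleaf⟩ := h
    exact ⟨F, hF, hv, fun F' hF' hv' hne =>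
      (hP.2 F' hF' F hF hne v hv' hv).resolve_right hleaf⟩
  · push Not at h
    obtain ⟨w, hvw⟩ := hG.exists_adj_of_nontrivial v
    obtain ⟨F, hF, he⟩ := P.exists_mem (mem_edgeFinset.2 ((mem_edgeSet G).2 hvw))
    exact ⟨F, hF, ⟨w, (fromEdgeSet_adj_iff (P.le hF)).2 he⟩, fun F' hF' hv' _ => h F' hF' hv'⟩

/-- A leaf `v` of all parts at `v` but `main v` has only one edge in each of these other parts. -/
theorem exists_sum_card_lt [Fintype V] [Nontrivial V] (hP : IsProperDecomposition pos P)
    (hG : G.IsTree) : ∃ main : V → Finset (Sym2 V),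
      ∑ v, #{e ∈ G.edgeFinset | v ∈ e ∧ P.part e ≠ main v} < #P.parts := by
  classical
  choose main hmain hmem hleaf using hP.exists_main hG.connected.preconnected
  refine ⟨main, ?_⟩
  rw [← sum_card_ne_main hG (fun F hF => (hP.1 F hF).1) hmain hmem, Nat.lt_succ_iff]
  have hpart {v : V} {e : Sym2 V} (he : e ∈ G.edgeFinset) (hv : v ∈ e) :
      P.part e ∈ P.parts ∧ v ∈ partVerts (P.part e) := by
    obtain ⟨w, rfl⟩ := hv
    have hF := P.part_mem.2 he
    exact ⟨hF, w, (fromEdgeSet_adj_iff (P.le hF)).2 (P.mem_part he)⟩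
  refine sum_le_sum fun v _ => card_le_card_of_injOn P.part (fun e he => ?_) fun e he f hf hef => ?_
  · obtain ⟨he, hve, hne⟩ := mem_filter.1 he
    exact mem_filter.2 ⟨(hpart he hve).1, (hpart he hve).2, hne⟩
  · obtain ⟨he, hve, hne⟩ := mem_filter.1 he
    obtain ⟨hf, hvf, -⟩ := mem_filter.1 hf
    exact eq_of_part_eq_of_isLeafOf he hf hve hvf hef
      (hleaf v _ (hpart he hve).1 (hpart he hve).2 hne)

end IsProperDecomposition

end Partition

/-- Two nodes of a rooted tree that stand for edges in conflict. -/
def NodesConflict (G : SimpleGraph V) (pos : V → Plane) (enode : Sym2 V → ℕ) (a b : ℕ) : Prop :=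
  ∃ e ∈ G.edgeSet, ∃ f ∈ G.edgeSet, Conflicts pos e f ∧ enode e = a ∧ enode f = b

namespace IsRooting

variable {m : ℕ} {p : ℕ → ℕ} {node : V → ℕ} {enode : Sym2 V → ℕ}

omit [Fintype G.edgeSet] in
theorem exists_extend [Nonempty V] {γ : Type*} (hR : IsRooting G m p node enode) (c : V → γ)
    (d : Sym2 V → γ) :
    ∃ M : ℕ → γ, (∀ v, M (node v) = c v) ∧ ∀ e ∈ G.edgeSet, M (enode e) = d e := by
  classical
  have : Nonempty (Sym2 V) := Nonempty.map Sym2.diag ‹_›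
  refine ⟨Function.extend node c fun x => d (Function.invFunOn enode G.edgeSet x),
    hR.node_injective.extend_apply _ _, fun e he => ?_⟩
  rw [Function.extend_apply', hR.enode_bijOn.injOn.leftInvOn_invFunOn he]
  rintro ⟨v, hv⟩
  exact Nat.not_even_iff_odd.2 (hR.odd_enode he) (hv ▸ hR.even_node v)

theorem card_ne_parent_le {γ : Type*} [DecidableEq γ] [Fintype V] [DecidableEq V]
    (hR : IsRooting G m p node enode) {c : V → γ} {d : Sym2 V → γ} {M : ℕ → γ}
    (hc : ∀ v, M (node v) = c v) (hd : ∀ e ∈ G.edgeSet, M (enode e) = d e) :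
    #{x ∈ range (2 * m + 1) | M x ≠ M (p x)} ≤ ∑ v, #{e ∈ G.edgeFinset | v ∈ e ∧ d e ≠ c v} := by
  rw [← card_sigma]
  refine card_le_card_of_surjOn
    (fun i => if p (enode i.2) = node i.1 then enode i.2 else node i.1) fun x hx => ?_
  obtain ⟨hx, hM⟩ := mem_filter.1 hx
  have hx0 : 0 < x := Nat.pos_of_ne_zero fun h => hM (by rw [h, hR.parent_zero])
  rw [mem_range] at hx
  rcases Nat.even_or_odd x with hx' | hx'
  · obtain ⟨v, rfl⟩ := hR.exists_eq_node (by omega) hx'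
    obtain ⟨u, he, hpv, hpe⟩ := hR.exists_adj_of_lt hx0
    refine ⟨⟨v, s(u, v)⟩, ?_, if_neg ?_⟩
    · rw [hpv, hc, hd _ he] at hM
      simpa [hM.symm] using he
    · rw [hpe]
      exact fun h => G.ne_of_adj he (hR.node_injective h)
  · obtain ⟨u, v, he, rfl, hpe, -⟩ := hR.exists_eq_enode (by grind) hx'
    refine ⟨⟨u, s(u, v)⟩, ?_, if_pos hpe⟩
    rw [hpe, hc, hd _ he] at hM
    simpa [hM] using he

variable [DecidableEq V] {C : Finset ℕ}

theorem card_lt_of_greedyInvariant [Finite V] [Nontrivial V] (hpos : Function.Injective pos)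
    (hG : G.IsTree) (hR : IsRooting G m p node enode)
    (hC : GreedyInvariant (Finset (Sym2 V)) p (2 * m + 1) (NodesConflict G pos enode) 0 0 C)
    {P : Finpartition G.edgeFinset} (hP : IsProperDecomposition pos P) :
    #C + 1 < 2 * #P.parts := by
  have := Fintype.ofFinite V
  obtain ⟨main, hmain⟩ := hP.exists_sum_card_lt hG
  obtain ⟨M, hMnode, hMenode⟩ := hR.exists_extend main P.part
  have hM (a b : ℕ) : NodesConflict G pos enode a b → M a ≠ M b := by
    rintro ⟨e, he, f, hf, hef, rfl, rfl⟩ h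
    rw [hMenode e he, hMenode f hf] at h
    rw [← mem_edgeFinset] at he hf
    have hF := P.part_mem.2 he
    exact ((isIncreasingChordSubtree_iff hpos (not_isDiag_of_subset (P.le hF))).1
      (hP.1 _ hF)).2 e (P.mem_part he) f (h ▸ P.mem_part hf) hef
  have hchanges := hR.card_ne_parent_le hMnode hMenode
  have hcuts : #C ≤ 2 * #{x ∈ range (2 * m + 1) | M x ≠ M (p x)} :=
    (hC.card_le M hM).trans (by gcongr; exact And.left)
  omega

theorem isProperDecomposition_of_greedyInvariant (hpos : Function.Injective pos)
    (hG : G.IsAcyclic) (hR : IsRooting G m p node enode) {γ : Type*} [DecidableEq γ]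
    (hC : GreedyInvariant γ p (2 * m + 1) (NodesConflict G pos enode) 0 0 C) :
    IsProperDecomposition pos (fibrePartition G.edgeFinset fun e => top p C 0 (enode e)) :=
  hR.isProperDecomposition hpos hG fun e he f hf hef =>
    hC.separated _ _ ⟨e, he, f, hf, hef, rfl, rfl⟩

theorem card_parts_lt_two_mul_optSize [Finite V] [Nontrivial V] (hpos : Function.Injective pos)
    (hG : G.IsTree) (hR : IsRooting G m p node enode)
    (hC : GreedyInvariant (Finset (Sym2 V)) p (2 * m + 1) (NodesConflict G pos enode) 0 0 C) :
    #(fibrePartition G.edgeFinset fun e => top p C 0 (enode e)).parts <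
      2 * optSize G pos := by
  obtain ⟨P, hP, hopt⟩ := Nat.sInf_mem (s := {k : ℕ | ∃ P :
    Finpartition G.edgeFinset, IsProperDecomposition pos P ∧ P.parts.card = k})
    ⟨_, _, hR.isProperDecomposition_of_greedyInvariant hpos hG.isAcyclic hC, rfl⟩
  have hparts := hR.card_parts_le (C := C)
  have hcuts := hR.card_lt_of_greedyInvariant hpos hG hC hP
  rw [hopt] at hcuts
  exact hparts.trans_lt hcuts

end IsRooting

end TreeDrawing

/-! ### Correctness and running time of programs -/

namespace RealRAM

/-- The state after the assignment of `v` to a variable. -/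
abbrev State.setVar (s : State) (x v : ℕ) : State :=
  { s with nvar := Function.update s.nvar x v }

/-- The state after the assignment of `v` to a cell of a natural array. -/
abbrev State.setNat (s : State) (a i v : ℕ) : State :=
  { s with narr := Function.update s.narr a (Function.update (s.narr a) i v) }

namespace Cmd

open Polynomial in
/-- A bound for the running time of a program, as a polynomial in a number that bounds how often the
body of each loop is repeated whenever the loop is reached. -/
noncomputable def timePoly : Cmd → ℕ[X]
  | skip => 1
  | setVar _ e => C (e.cost + 1)
  | setNat _ i e => C (i.cost + e.cost + 1)
  | setReal _ i e => C (i.cost + e.cost + 1)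
  | seq p q => p.timePoly + q.timePoly
  | ite b p q => C b.cost + (p.timePoly + q.timePoly)
  | loop b p => X * (C b.cost + p.timePoly) + C b.cost

/-- Started in the state `s`, the program `c` halts within the time `c.timePoly.eval N` and `Q`
holds then. -/
def Runs (N : ℕ) (c : Cmd) (s : State) (Q : State → Prop) : Prop :=
  ∃ t s', Exec c s t s' ∧ t ≤ c.timePoly.eval N ∧ Q s'

/-- Run `c` with `x = k - 1, …, 1, 0` where `k` is the value of `e`. -/
def forDown (x : ℕ) (e : NExp) (c : Cmd) : Cmd :=
  .seq (.setVar x e) <|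
    .loop (.nle (.const 1) (.var x)) (.seq (.setVar x (.sub (.var x) (.const 1))) c)

namespace Runs

variable {N : ℕ} {b : Test} {c d : Cmd} {s : State} {Q Q' : State → Prop}

theorem mono (h : Runs N c s Q) (hQ : ∀ s, Q s → Q' s) : Runs N c s Q' := by
  obtain ⟨t, s', hexec, ht, hs'⟩ := h
  exact ⟨t, s', hexec, ht, hQ s' hs'⟩

theorem skip (h : Q s) : Runs N .skip s Q :=
  ⟨_, _, .skip s, by simp [timePoly], h⟩

theorem setVar {x : ℕ} {e : NExp} (h : Q (s.setVar x (e.val s))) : Runs N (.setVar x e) s Q :=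
  ⟨_, _, .setVar s x e, by simp [timePoly], h⟩

theorem setNat {a : ℕ} {i e : NExp} (h : Q (s.setNat a (i.val s) (e.val s))) :
    Runs N (.setNat a i e) s Q :=
  ⟨_, _, .setNat s a i e, by simp [timePoly], h⟩

theorem seq (h : Runs N c s fun s' => Runs N d s' Q) : Runs N (.seq c d) s Q := by
  obtain ⟨t, s', hc, ht, t', s'', hd, ht', hQ⟩ := h
  exact ⟨_, _, .seq hc hd, by simpa [timePoly] using add_le_add ht ht', hQ⟩

theorem ite (hc : b.Holds s → Runs N c s Q) (hd : ¬b.Holds s → Runs N d s Q) :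
    Runs N (.ite b c d) s Q := by
  by_cases hb : b.Holds s
  · obtain ⟨t, s', hexec, ht, hQ⟩ := hc hb
    exact ⟨_, _, .ite_true hb hexec, by simp [timePoly]; omega, hQ⟩
  · obtain ⟨t, s', hexec, ht, hQ⟩ := hd hb
    exact ⟨_, _, .ite_false hb hexec, by simp [timePoly]; omega, hQ⟩

theorem loop {I : ℕ → State → Prop} {k : ℕ} (hk : k ≤ N) (h : I k s)
    (hholds : ∀ k s, I k s → (b.Holds s ↔ 0 < k))
    (hstep : ∀ i < k, ∀ s, I (i + 1) s → Runs N c s (I i)) : Runs N (.loop b c) s (I 0) := by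
  suffices H : ∃ t s', Exec (.loop b c) s t s' ∧
      t ≤ k * (b.cost + c.timePoly.eval N) + b.cost ∧ I 0 s' by
    obtain ⟨t, s', hexec, ht, hI⟩ := H
    refine ⟨t, s', hexec, ht.trans ?_, hI⟩
    simp only [timePoly, Polynomial.eval_add, Polynomial.eval_mul, Polynomial.eval_X,
      Polynomial.eval_C]
    gcongr
  clear hk
  induction k generalizing s with
  | zero => exact ⟨_, _, .loop_false ((hholds 0 s h).not.2 (by simp)), by simp, h⟩
  | succ k ih =>
    obtain ⟨t, s', hexec, ht, hI⟩ := hstep k (by omega) s h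
    obtain ⟨t', s'', hexec', ht', hI'⟩ := ih hI fun i hi => hstep i (by omega)
    exact ⟨_, _, .loop_true ((hholds _ s h).2 (by simp)) hexec hexec', by grind, hI'⟩

theorem forDown {x : ℕ} {e : NExp} {I : ℕ → State → Prop} (hN : e.val s ≤ N)
    (h : I (e.val s) (s.setVar x (e.val s))) (hx : ∀ k s, I k s → s.nvar x = k)
    (hstep : ∀ k < e.val s, ∀ s, I (k + 1) s → Runs N c (s.setVar x k) (I k)) :
    Runs N (.forDown x e c) s (I 0) := by
  refine seq (setVar (loop hN h (fun k s hI => ?_) fun k hk s hI => seq (setVar ?_)))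
  · simp only [Test.Holds, NExp.val, hx k s hI]
    omega
  · simpa only [NExp.val, hx _ s hI, Nat.add_sub_cancel] using hstep k hk s hI

end Runs

end Cmd

/-- Disjunction of tests. -/
def Test.disj (b c : Test) : Test := .neg (.conj (.neg b) (.neg c))

/-- Equality of natural numbers as a test. -/
def Test.nateq (e f : NExp) : Test := .conj (.nle e f) (.nle f e)

theorem Test.disj_holds {b c : Test} {s : State} : (disj b c).Holds s ↔ b.Holds s ∨ c.Holds s := by
  simp only [disj, Holds]
  tauto

theorem Test.nateq_holds {e f : NExp} {s : State} : (nateq e f).Holds s ↔ e.val s = f.val s := by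
  simp only [nateq, Holds]
  omega

end RealRAM

/-! ### The input and the conflict test -/

namespace RealRAM

open TreeDrawing

namespace NExp

/-- The number of edges. -/
abbrev edgeCount : NExp := .sub (.var 0) (.const 1)

/-- The last number given to a node of the subdivided tree. -/
abbrev lastNode : NExp := .var 1

/-- The first endpoint of an edge. -/
abbrev fst (e : NExp) : NExp := .read 0 e

/-- The second endpoint of an edge. -/
abbrev snd (e : NExp) : NExp := .read 1 e

/-- The label of an edge: at first the node that subdivides the edge, at last the part that contains
the edge. -/
abbrev label (e : NExp) : NExp := .read 2 e

/-- The node that stands for a vertex. -/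
abbrev node (v : NExp) : NExp := .read 3 v

/-- The parent of a node. -/
abbrev parent (x : NExp) : NExp := .read 4 x

/-- This is zero as long as the edge from the node `x` to its parent has not been cut. -/
abbrev isCut (x : NExp) : NExp := .read 5 x

end NExp

/-- The state still contains the input. -/
structure HasInput {m : ℕ} (ends : Fin m → Fin (m + 1) × Fin (m + 1)) (pos : Fin (m + 1) → Plane)
    (s : State) : Prop where
  vertexCount : s.nvar 0 = m + 1
  fst : ∀ i : Fin m, s.narr 0 i = (ends i).1
  snd : ∀ i : Fin m, s.narr 1 i = (ends i).2
  coord_zero : ∀ v : Fin (m + 1), s.rarr 0 v = pos v 0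
  coord_one : ∀ v : Fin (m + 1), s.rarr 1 v = pos v 1

/-- The test whether `x` lies beyond `v` on the ray from `u` through `v`, or next to it: the
coordinates of `v - u` and `x - v` have a nonnegative inner product. -/
def Test.beyond (u v x : NExp) : Test :=
  .rle (.const 0) (.add (.mul (diff 0 x v) (diff 0 v u)) (.mul (diff 1 x v) (diff 1 v u)))
where
  /-- The difference of two vertices in the coordinate `d`. -/
  diff (d : ℕ) (v w : NExp) : RExp := .sub (.read d v) (.read d w)

/-- The test whether the edges `a` and `b` conflict. -/
def Test.conflict (a b : NExp) : Test :=
  .conj (.neg (nateq a b)) <| .neg <| disj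
    (.conj (beyond a.fst a.snd b.fst) (beyond a.fst a.snd b.snd))
    (.conj (beyond a.snd a.fst b.fst) (beyond a.snd a.fst b.snd))

namespace HasInput

variable {m : ℕ} {ends : Fin m → Fin (m + 1) × Fin (m + 1)} {pos : Fin (m + 1) → Plane} {s : State}

theorem inputState : HasInput ends pos (inputState (m + 1) ends pos) where
  vertexCount := by simp [RealRAM.inputState]
  fst := by simp [RealRAM.inputState]
  snd := by simp [RealRAM.inputState]
  coord_zero v := by simp [RealRAM.inputState, v.is_le]
  coord_one v := by simp [RealRAM.inputState, v.is_le]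

theorem setVar (h : HasInput ends pos s) {x : ℕ} (hx : x ≠ 0) (v : ℕ) :
    HasInput ends pos (s.setVar x v) :=
  { h with vertexCount := by simp [h.vertexCount, hx.symm] }

theorem setNat (h : HasInput ends pos s) {a : ℕ} (ha : 2 ≤ a) (i v : ℕ) :
    HasInput ends pos (s.setNat a i v) :=
  { h with
    fst := by simp [h.fst, show 0 ≠ a by omega]
    snd := by simp [h.snd, show 1 ≠ a by omega] }

theorem edgeCount_val (h : HasInput ends pos s) : NExp.edgeCount.val s = m := by
  simp [NExp.val, h.vertexCount]

theorem beyond_holds (h : HasInput ends pos s) {u v x : NExp} {u' v' x' : Fin (m + 1)}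
    (hu : u.val s = u') (hv : v.val s = v') (hx : x.val s = x') :
    (Test.beyond u v x).Holds s ↔ 0 ≤ inner ℝ (pos x' - pos v') (pos v' - pos u') := by
  simp [Test.beyond, Test.beyond.diff, Test.Holds, RExp.val, hu, hv, hx, h.coord_zero, h.coord_one,
    PiLp.inner_apply, mul_comm]

theorem conflict_holds (h : HasInput ends pos s)
    (hinj : Function.Injective fun i => s((ends i).1, (ends i).2)) {a b : NExp} {i j : Fin m}
    (ha : a.val s = i) (hb : b.val s = j) : (Test.conflict a b).Holds s ↔
      Conflicts pos s((ends i).1, (ends i).2) s((ends j).1, (ends j).2) := by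
  have hai : a.fst.val s = (ends i).1 := by rw [NExp.val, ha, h.fst]
  have hai' : a.snd.val s = (ends i).2 := by rw [NExp.val, ha, h.snd]
  have hbj : b.fst.val s = (ends j).1 := by rw [NExp.val, hb, h.fst]
  have hbj' : b.snd.val s = (ends j).2 := by rw [NExp.val, hb, h.snd]
  rw [conflicts_mk_iff, hinj.ne_iff, SameSide, Test.conflict]
  simp only [Test.Holds, Test.disj_holds, Test.nateq_holds, ha, hb, Fin.val_inj,
    h.beyond_holds hai hai' hbj, h.beyond_holds hai hai' hbj', h.beyond_holds hai' hai hbj,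
    h.beyond_holds hai' hai hbj']

end HasInput

end RealRAM

/-! ### Rooting the tree -/

namespace RealRAM

open TreeDrawing

/-- The vertex `v` has been given a node. Unused cells contain `0`, but `0` is also the node of the
root, which is the vertex `0`. -/
def IsNumbered (node : ℕ → ℕ) (v : ℕ) : Prop :=
  v = 0 ∨ 0 < node v

/-- The nodes `0, …, K` have been given to the vertices and edges of a subtree that contains the
root, in accordance with `TreeDrawing.IsRooting`. -/
structure Numbering {m : ℕ} (ends : Fin m → Fin (m + 1) × Fin (m + 1)) (K : ℕ)
    (node parent label : ℕ → ℕ) : Prop where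
  even_last : Even K
  node_bijOn : Set.BijOn (fun v : Fin (m + 1) => node v) {v | IsNumbered node v}
    {x | x ≤ K ∧ Even x}
  node_zero : node 0 = 0
  parent_zero : parent 0 = 0
  parent_lt : ∀ x, 0 < x → parent x < x
  exists_label : ∀ x < K, Odd x → ∃ (i : Fin m) (u v : Fin (m + 1)), label i = x ∧
    s((ends i).1, (ends i).2) = s(u, v) ∧ IsNumbered node u ∧ parent x = node u ∧
    node v = x + 1 ∧ parent (x + 1) = x

theorem isNumbered_update {node : ℕ → ℕ} {v x w : ℕ} (hx : 0 < x) :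
    IsNumbered (Function.update node v x) w ↔ w = v ∨ IsNumbered node w := by
  by_cases h : w = v <;> simp [IsNumbered, h, hx]

namespace Numbering

variable {m : ℕ} {ends : Fin m → Fin (m + 1) × Fin (m + 1)} {K : ℕ} {node parent label : ℕ → ℕ}

theorem zero : Numbering ends 0 0 0 0 where
  even_last := by simp
  node_bijOn := by
    refine ⟨fun v _ => by simp, fun v hv w hw _ => ?_, fun x hx => ⟨0, Or.inl rfl, ?_⟩⟩
    · simp_all [IsNumbered]
    · have := hx.1
      simp only [Pi.zero_apply]
      omega
  node_zero := rfl
  parent_zero := rfl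
  parent_lt x hx := hx
  exists_label x hx := by omega

theorem node_le (h : Numbering ends K node parent label) {v : Fin (m + 1)}
    (hv : IsNumbered node v) : node v ≤ K :=
  (h.node_bijOn.mapsTo hv).1

theorem node_bijOn_update (h : Numbering ends K node parent label) {v : Fin (m + 1)}
    (hv : ¬IsNumbered node v) :
    Set.BijOn (fun w : Fin (m + 1) => Function.update node v (K + 2) w)
      {w | IsNumbered (Function.update node v (K + 2)) w} {x | x ≤ K + 2 ∧ Even x} := by
  have hne {w : Fin (m + 1)} (hw : IsNumbered node w) : (w : ℕ) ≠ v := fun h => hv (h ▸ hw)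
  have hbij : Set.BijOn (fun w : Fin (m + 1) => Function.update node v (K + 2) w)
      {w | IsNumbered node w} {x | x ≤ K ∧ Even x} :=
    h.node_bijOn.congr fun w hw => by simp [hne hw]
  convert hbij.insert (a := v) (by simp) using 1
  · ext w
    simp [isNumbered_update, Fin.val_inj]
  · ext x
    have := h.even_last
    simp only [Function.update_self, Set.mem_ofPred_eq, Set.mem_insert_iff]
    grind

theorem attach (h : Numbering ends K node parent label) {i : Fin m} {u v : Fin (m + 1)}
    (he : s((ends i).1, (ends i).2) = s(u, v)) (hu : IsNumbered node u) (hv : ¬IsNumbered node v) :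
    Numbering ends (K + 2) (Function.update node v (K + 2))
      (Function.update (Function.update parent (K + 1) (node u)) (K + 2) (K + 1))
      (Function.update label i (K + 1)) where
  even_last := h.even_last.add even_two
  node_bijOn := h.node_bijOn_update hv
  node_zero := by
    have hv0 : (v : ℕ) ≠ 0 := fun h => hv (Or.inl h)
    simp [hv0.symm, h.node_zero]
  parent_zero := by simp [h.parent_zero]
  parent_lt x hx := by
    have := h.node_le hu
    have := h.parent_lt x hx
    grind
  exists_label x hx hodd := by
    have huv : (u : ℕ) ≠ v := fun h => hv (h ▸ hu)
    have hK := h.even_last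
    obtain rfl | hx : x = K + 1 ∨ x < K := by grind
    · exact ⟨i, u, v, by simp, he, (isNumbered_update (by omega)).2 (Or.inr hu), by simp [huv],
        by simp, by simp⟩
    · obtain ⟨j, u', v', hj, he', hu', hpu, hv', hpv⟩ := h.exists_label x hx hodd
      have hv'n : IsNumbered node v' := Or.inr (by omega)
      have hji : (j : ℕ) ≠ i := fun hji => by
        rw [Fin.ext hji, he, Sym2.eq_iff] at he'
        rcases he' with ⟨-, rfl⟩ | ⟨-, rfl⟩
        exacts [hv hv'n, hv hu']
      have hvu' : (u' : ℕ) ≠ v := fun h => hv (h ▸ hu')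
      have hvv' : (v' : ℕ) ≠ v := fun h => hv (h ▸ hv'n)
      refine ⟨j, u', v', by simp [hji, hj], he', (isNumbered_update (by omega)).2 (Or.inr hu'), ?_⟩
      have := h.node_le hv'n
      simp [hvu', hvv', hpu, hv', hpv, show x ≠ K + 1 by omega, show x ≠ K + 2 by omega,
        show x ≠ K by omega]

theorem exists_injective (h : Numbering ends K node parent label) :
    ∃ f : Fin (K / 2 + 1) → Fin (m + 1), Function.Injective f ∧ ∀ k, IsNumbered node (f k) := by
  have hex (k : Fin (K / 2 + 1)) : ∃ v : Fin (m + 1), IsNumbered node v ∧ node v = 2 * k :=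
    h.node_bijOn.surjOn (a := 2 * k) ⟨by omega, even_two_mul _⟩
  choose f hf hnode using hex
  refine ⟨f, fun k l hkl => ?_, hf⟩
  have := hnode k
  have := hnode l
  rw [hkl] at *
  omega

theorem le_two_mul (h : Numbering ends K node parent label) : K ≤ 2 * m := by
  obtain ⟨f, hf, -⟩ := h.exists_injective
  have := Fintype.card_le_of_injective f hf
  simp only [Fintype.card_fin] at this
  have := h.even_last
  grind

theorem isNumbered (h : Numbering ends (2 * m) node parent label) (v : Fin (m + 1)) :
    IsNumbered node v := by
  obtain ⟨f, hf, hnum⟩ := h.exists_injective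
  obtain ⟨k, rfl⟩ := ((Fintype.bijective_iff_injective_and_card f).2 ⟨hf, by simp⟩).surjective v
  exact hnum k

theorem exists_not_isNumbered (h : Numbering ends K node parent label) (hK : K < 2 * m) :
    ∃ v : Fin (m + 1), ¬IsNumbered node v := by
  by_contra! hall
  have hinj : Function.Injective fun v : Fin (m + 1) =>
      (⟨node v / 2, by have := h.node_le (hall v); omega⟩ : Fin (K / 2 + 1)) := fun v w hvw => by
    have hv := (h.node_bijOn.mapsTo (hall v)).2
    have hw := (h.node_bijOn.mapsTo (hall w)).2
    refine h.node_bijOn.injOn (hall v) (hall w) ?_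
    simp only [Fin.mk.injEq] at hvw
    grind
  have := Fintype.card_le_of_injective _ hinj
  simp only [Fintype.card_fin] at this
  omega

theorem exists_crossing (h : Numbering ends K node parent label) (hK : K < 2 * m)
    {G : SimpleGraph (Fin (m + 1))} (hG : G.Connected)
    (hends : Set.SurjOn (fun i => s((ends i).1, (ends i).2)) Set.univ G.edgeSet) :
    ∃ i : Fin m, ¬(IsNumbered node (ends i).1 ↔ IsNumbered node (ends i).2) := by
  obtain ⟨v, hv⟩ := h.exists_not_isNumbered hK
  obtain ⟨w⟩ := hG.preconnected 0 v
  obtain ⟨d, -, hd, hd'⟩ := w.exists_boundary_dart {v | IsNumbered node v} (Or.inl rfl) hv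
  obtain ⟨i, -, hi⟩ := hends d.edge_mem
  refine ⟨i, ?_⟩
  rcases Sym2.eq_iff.1 (show s((ends i).1, (ends i).2) = s(d.fst, d.snd) from hi) with
    ⟨h₁, h₂⟩ | ⟨h₁, h₂⟩ <;> rw [h₁, h₂] <;> tauto

theorem label_bijOn (h : Numbering ends (2 * m) node parent label) :
    Set.BijOn (fun i : Fin m => label i) Set.univ {x | x < 2 * m ∧ Odd x} := by
  have hex (k : Fin m) : ∃ i : Fin m, label i = 2 * k + 1 := by
    obtain ⟨i, -, -, hi, -⟩ := h.exists_label (2 * k + 1) (by omega) (odd_two_mul_add_one _)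
    exact ⟨i, hi⟩
  choose f hf using hex
  have hinj : Function.Injective f := fun k l hkl => by
    have := hf k
    have := hf l
    rw [hkl] at *
    omega
  have hsurj : Function.Surjective f := Finite.surjective_of_injective hinj
  refine ⟨fun i _ => ?_, fun i _ j _ hij => ?_, fun x hx => ?_⟩
  · obtain ⟨k, rfl⟩ := hsurj i
    simp only [hf]
    exact ⟨by omega, odd_two_mul_add_one _⟩
  · obtain ⟨k, rfl⟩ := hsurj i
    obtain ⟨l, rfl⟩ := hsurj j
    simp only [hf] at hij
    rw [show k = l by omega]
  · obtain ⟨i, -, -, hi, -⟩ := h.exists_label x hx.1 hx.2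
    exact ⟨i, Set.mem_univ i, hi⟩

theorem exists_isRooting (h : Numbering ends (2 * m) node parent label)
    {G : SimpleGraph (Fin (m + 1))}
    (hends : Set.BijOn (fun i => s((ends i).1, (ends i).2)) Set.univ G.edgeSet) :
    ∃ enode : Sym2 (Fin (m + 1)) → ℕ, (∀ i : Fin m, enode s((ends i).1, (ends i).2) = label i) ∧
      IsRooting G m parent (fun v => node v) enode := by
  obtain ⟨enode, henode⟩ : ∃ enode : Sym2 (Fin (m + 1)) → ℕ,
      ∀ i : Fin m, enode s((ends i).1, (ends i).2) = label i :=
    ⟨Function.extend _ _ 0, (Set.injOn_univ.1 hends.injOn).extend_apply (fun i => label i) 0⟩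
  refine ⟨enode, henode, ⟨?_, ?_, h.parent_zero, h.parent_lt, fun e he => ?_⟩⟩
  · simpa only [h.isNumbered, Set.ofPred_true] using h.node_bijOn
  · rw [← hends.image_eq]
    refine (Set.bijOn_comp_iff hends.injOn).1 ?_
    exact h.label_bijOn.congr fun i _ => (henode i).symm
  · obtain ⟨i, -, rfl⟩ := hends.surjOn he
    obtain ⟨hlt, hodd⟩ := h.label_bijOn.mapsTo (Set.mem_univ i)
    obtain ⟨j, u, v, hj, hjuv, -, hu, hv, hpv⟩ := h.exists_label _ hlt hodd
    obtain rfl := h.label_bijOn.injOn (Set.mem_univ j) (Set.mem_univ i) hj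
    simp only [henode]
    exact ⟨u, v, hjuv, hu, hv, hv ▸ hpv⟩

end Numbering

/-- The test whether a vertex has a node. -/
def Test.isNumbered (v : NExp) : Test := .disj (.nle v (.const 0)) (.nle (.const 1) v.node)

namespace Cmd

/-- Append the edge with index in variable `3`, from its upper end `u` to its lower end `v`, to the
rooted subtree. -/
def attach (u v : NExp) : Cmd :=
  .seq (.setNat 4 (.add .lastNode (.const 1)) u.node) <|
  .seq (.setNat 4 (.add .lastNode (.const 2)) (.add .lastNode (.const 1))) <|
  .seq (.setNat 3 v (.add .lastNode (.const 2))) <|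
  .seq (.setNat 2 (.var 3) (.add .lastNode (.const 1))) <|
  .setVar 1 (.add .lastNode (.const 2))

/-- Append an edge if it has exactly one end in the rooted subtree. -/
def visit : Cmd :=
  .ite (.isNumbered (NExp.fst (.var 3)))
    (.ite (.isNumbered (NExp.snd (.var 3))) .skip (attach (NExp.fst (.var 3)) (NExp.snd (.var 3))))
    (.ite (.isNumbered (NExp.snd (.var 3))) (attach (NExp.snd (.var 3)) (NExp.fst (.var 3))) .skip)

/-- Root the tree at the vertex `0`. Each of the rounds appends an edge. -/
def root : Cmd := .forDown 2 .edgeCount (.forDown 3 .edgeCount .visit)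

end Cmd

/-- The state while the tree is being rooted. -/
structure RootingState {m : ℕ} (ends : Fin m → Fin (m + 1) × Fin (m + 1))
    (pos : Fin (m + 1) → Plane) (K : ℕ) (s : State) : Prop extends HasInput ends pos s where
  lastNode : s.nvar 1 = K
  numbering : Numbering ends K (s.narr 3) (s.narr 4) (s.narr 2)
  isCut : s.narr 5 = 0

namespace RootingState

variable {m : ℕ} {ends : Fin m → Fin (m + 1) × Fin (m + 1)} {pos : Fin (m + 1) → Plane} {K N : ℕ}
  {s : State}

theorem inputState : RootingState ends pos 0 (inputState (m + 1) ends pos) where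
  toHasInput := .inputState
  lastNode := by simp [RealRAM.inputState]
  numbering := by
    convert Numbering.zero <;> · ext; simp [RealRAM.inputState]
  isCut := by ext; simp [RealRAM.inputState]

theorem setVar (h : RootingState ends pos K s) {x : ℕ} (hx : 2 ≤ x) (v : ℕ) :
    RootingState ends pos K (s.setVar x v) where
  toHasInput := h.toHasInput.setVar (by omega) v
  lastNode := by simp [h.lastNode, show 1 ≠ x by omega]
  numbering := h.numbering
  isCut := h.isCut

theorem isNumbered_holds {e : NExp} {v : ℕ} (he : e.val s = v) :
    (Test.isNumbered e).Holds s ↔ IsNumbered (s.narr 3) v := by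
  simp only [Test.isNumbered, Test.disj_holds, Test.Holds, NExp.val, he, IsNumbered]
  omega

theorem runs_attach (h : RootingState ends pos K s) {i : Fin m} (hi : s.nvar 3 = i)
    {d d' : ℕ} {u v : Fin (m + 1)} (hu : s.narr d i = u) (hv : s.narr d' i = v)
    (hd' : d' ≠ 4) (he : s((ends i).1, (ends i).2) = s(u, v))
    (hun : IsNumbered (s.narr 3) u) (hvn : ¬IsNumbered (s.narr 3) v) :
    (Cmd.attach (.read d (.var 3)) (.read d' (.var 3))).Runs N s fun s' =>
      RootingState ends pos (K + 2) s' ∧ ∀ x ≠ 1, s'.nvar x = s.nvar x := by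
  refine .seq <| .setNat <| .seq <| .setNat <| .seq <| .setNat <| .seq <| .setNat <| .setVar ?_
  simp only [NExp.val, h.lastNode, hi, hu, Function.update_self, ne_eq, hd', not_false_eq_true,
    Function.update_of_ne, hv]
  refine ⟨⟨?_, ?_, ?_, ?_⟩, ?_⟩
  · exact h.toHasInput.setNat (by omega) _ _ |>.setNat (by omega) _ _ |>.setNat (by omega) _ _
      |>.setNat (by omega) _ _ |>.setVar (by omega) _
  · simp
  · simpa using h.numbering.attach he hun hvn
  · simpa using h.isCut
  · intro x hx
    simp [hx]

theorem runs_visit (h : RootingState ends pos K s) {i : Fin m} (hi : s.nvar 3 = i) :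
    Cmd.visit.Runs N s fun s' => ∃ K', RootingState ends pos K' s' ∧
      (∀ x ≠ 1, s'.nvar x = s.nvar x) ∧ (K' = K + 2 ∨ K' = K ∧
        s'.narr = s.narr ∧
        (IsNumbered (s.narr 3) (ends i).1 ↔ IsNumbered (s.narr 3) (ends i).2)) := by
  have hfst : (NExp.fst (.var 3)).val s = (ends i).1 := by simp [NExp.val, hi, h.fst]
  have hsnd : (NExp.snd (.var 3)).val s = (ends i).2 := by simp [NExp.val, hi, h.snd]
  refine .ite (fun h₁ => .ite (fun h₂ => ?_) fun h₂ => ?_) fun h₁ =>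
    .ite (fun h₂ => ?_) fun h₂ => ?_ <;>
    rw [isNumbered_holds hfst] at h₁ <;> rw [isNumbered_holds hsnd] at h₂
  · exact .skip ⟨K, h, fun _ _ => rfl, Or.inr ⟨rfl, rfl, iff_of_true h₁ h₂⟩⟩
  · exact (h.runs_attach hi (h.fst i) (h.snd i) (by omega) rfl h₁ h₂).mono
      fun s' h' => ⟨_, h'.1, h'.2, Or.inl rfl⟩
  · exact (h.runs_attach hi (h.snd i) (h.fst i) (by omega) Sym2.eq_swap h₂ h₁).mono
      fun s' h' => ⟨_, h'.1, h'.2, Or.inl rfl⟩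
  · exact .skip ⟨K, h, fun _ _ => rfl, Or.inr ⟨rfl, rfl, iff_of_false h₁ h₂⟩⟩

theorem runs_round (h : RootingState ends pos K s) {G : SimpleGraph (Fin (m + 1))}
    (hG : G.Connected)
    (hends : Set.SurjOn (fun i => s((ends i).1, (ends i).2)) Set.univ G.edgeSet) (hN : m ≤ N)
    {r : ℕ} (hr : s.nvar 2 = r) (hK : 2 * m ≤ K + 2 * (r + 1)) :
    (Cmd.forDown 3 .edgeCount .visit).Runs N s fun s' =>
      s'.nvar 2 = r ∧ ∃ K', RootingState ends pos K' s' ∧ 2 * m ≤ K' + 2 * r := by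
  refine (Cmd.Runs.forDown (I := fun k s' => s'.nvar 2 = r ∧ s'.nvar 3 = k ∧
    ∃ K', RootingState ends pos K' s' ∧ (2 * m ≤ K' + 2 * r ∨ 2 * m ≤ K' + 2 * (r + 1) ∧
      ∀ i : Fin m, k ≤ i →
        (IsNumbered (s'.narr 3) (ends i).1 ↔ IsNumbered (s'.narr 3) (ends i).2)))
    (h.edgeCount_val.trans_le hN) ?_ (fun k s' hs' => hs'.2.1) ?_).mono ?_
  · rw [h.edgeCount_val]
    exact ⟨by simpa using hr, by simp, K, h.setVar (by omega) _, Or.inr ⟨hK, by omega⟩⟩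
  · rintro k hk s₁ ⟨hr₁, -, K₁, h₁, hK₁⟩
    lift k to Fin m using h.edgeCount_val ▸ hk
    refine ((h₁.setVar (x := 3) (by omega) k).runs_visit (i := k) (by simp)).mono ?_
    rintro s₂ ⟨K₂, h₂, hvar, hK₂⟩
    refine ⟨by rw [hvar] <;> simp [hr₁], by rw [hvar] <;> simp, K₂, h₂, ?_⟩
    rcases hK₂ with rfl | ⟨rfl, harr, hk⟩
    · exact Or.inl (by omega)
    · refine hK₁.imp_right fun ⟨hK₁, hscan⟩ => ⟨hK₁, fun i hi => ?_⟩
      rw [harr]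
      rcases hi.eq_or_lt with heq | hlt
      · rwa [← Fin.ext heq]
      · exact hscan i hlt
  · rintro s' ⟨hr', -, K', h', hK' | ⟨-, hscan⟩⟩
    · exact ⟨hr', K', h', hK'⟩
    · refine ⟨hr', K', h', ?_⟩
      by_contra! hlt
      obtain ⟨i, hi⟩ := h'.numbering.exists_crossing (by omega) hG hends
      exact hi (hscan i (Nat.zero_le _))

theorem runs_root {G : SimpleGraph (Fin (m + 1))} (hG : G.Connected)
    (hends : Set.SurjOn (fun i => s((ends i).1, (ends i).2)) Set.univ G.edgeSet) (hN : m ≤ N) :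
    Cmd.root.Runs N (RealRAM.inputState (m + 1) ends pos) (RootingState ends pos (2 * m)) := by
  have h₀ := inputState (ends := ends) (pos := pos)
  refine (Cmd.Runs.forDown (I := fun r s => s.nvar 2 = r ∧
    ∃ K, RootingState ends pos K s ∧ 2 * m ≤ K + 2 * r)
    (h₀.edgeCount_val.trans_le hN) ?_ (fun k s hs => hs.1) ?_).mono ?_
  · exact ⟨by simp, 0, h₀.setVar (by omega) _, by rw [h₀.edgeCount_val]; omega⟩
  · rintro r - s ⟨-, K, h, hK⟩
    exact (h.setVar (x := 2) (by omega) r).runs_round hG hends hN (by simp) hK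
  · rintro s ⟨-, K, h, hK⟩
    rwa [← show K = 2 * m from h.numbering.le_two_mul.antisymm hK]

end RootingState

end RealRAM

/-! ### Cutting the tree -/

namespace RealRAM

open TreeDrawing TreeMulticut

/-- The test whether the edge `e` is about to be joined to the node in variable `4`. -/
def Test.attaches (e : NExp) : Test :=
  .disj (.nateq e.label (.var 4))
    (.conj (.nateq e.label.parent (.var 4)) (.nateq e.label.isCut (.const 0)))

namespace Cmd

/-- Cut the edge through which `e` is about to be joined to the node in variable `4`. -/
def cutEdge (e : NExp) : Cmd :=
  .ite (.nateq e.label (.var 4)) .skip (.setNat 5 e.label (.const 1))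

/-- Prevent the edges with indices in the variables `5` and `6` from being joined at the node in
variable `4` if they conflict. -/
def resolve : Cmd :=
  .ite (.conj (.conflict (.var 5) (.var 6)) (.conj (.attaches (.var 5)) (.attaches (.var 6))))
    (.seq (.cutEdge (.var 5)) (.cutEdge (.var 6))) .skip

/-- Join the uncut children of the node in variable `4` to it. -/
def join : Cmd :=
  .forDown 5 .edgeCount (.ite (.attaches (.var 5)) (.setNat 2 (.var 5) (.var 4)) .skip)

/-- The greedy multicut algorithm. -/
def sweep : Cmd :=
  .forDown 4 (.add .lastNode (.const 1))
    (.seq (.forDown 5 .edgeCount (.forDown 6 .edgeCount .resolve)) .join)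

/-- The approximation algorithm. -/
def decompose : Cmd := .seq .root .sweep

end Cmd

/-- The state while the tree with parent function `p` is being cut; `C` is the set of cut edges. -/
structure SweepState {m : ℕ} (ends : Fin m → Fin (m + 1) × Fin (m + 1)) (pos : Fin (m + 1) → Plane)
    (p : ℕ → ℕ) (l : Fin m → ℕ) (C : Finset ℕ) (s : State) : Prop extends
    HasInput ends pos s where
  label : ∀ i : Fin m, s.narr 2 i = l i
  parent : s.narr 4 = p
  isCut : ∀ x, s.narr 5 x = 0 ↔ x ∉ C

/-- The relation between the nodes `x i` of the edges that expresses conflicts of edges. -/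
def ListConflict {m : ℕ} (ends : Fin m → Fin (m + 1) × Fin (m + 1)) (pos : Fin (m + 1) → Plane)
    (x : Fin m → ℕ) (a b : ℕ) : Prop :=
  ∃ i j, Conflicts pos s((ends i).1, (ends i).2) s((ends j).1, (ends j).2) ∧ x i = a ∧ x j = b

/-- The state while conflicts at the node `z` are being resolved; those between the edges in the
relation `S` are resolved already. -/
def ResolveState {m : ℕ} (γ : Type*) [DecidableEq γ] (ends : Fin m → Fin (m + 1) × Fin (m + 1))
    (pos : Fin (m + 1) → Plane) (p : ℕ → ℕ) (x : Fin m → ℕ) (M z : ℕ) (S : Fin m → Fin m → Prop)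
    (s : State) : Prop :=
  s.nvar 4 = z ∧ ∃ C, SweepState ends pos p (fun i => top p C (z + 1) (x i)) C s ∧
    GreedyInvariant γ p M (ListConflict ends pos x) z (z + 1) C ∧ ∀ i j, S i j →
      Conflicts pos s((ends i).1, (ends i).2) s((ends j).1, (ends j).2) →
        top p C z (x i) ≠ z ∨ top p C z (x j) ≠ z

section

variable {m : ℕ} {ends : Fin m → Fin (m + 1) × Fin (m + 1)} {pos : Fin (m + 1) → Plane}
  {p : ℕ → ℕ} {l : Fin m → ℕ} {C : Finset ℕ} {s : State} {x : Fin m → ℕ} {N M z : ℕ}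

namespace SweepState

theorem setVar (h : SweepState ends pos p l C s) {y : ℕ} (hy : y ≠ 0) (v : ℕ) :
    SweepState ends pos p l C (s.setVar y v) where
  toHasInput := h.toHasInput.setVar hy v
  label := h.label
  parent := h.parent
  isCut := h.isCut

theorem setLabel (h : SweepState ends pos p l C s) (i : Fin m) (v : ℕ) :
    SweepState ends pos p (Function.update l i v) C (s.setNat 2 i v) where
  toHasInput := h.toHasInput.setNat le_rfl i v
  label j := by
    rcases eq_or_ne j i with rfl | hji
    · simp
    · simp [hji, Fin.val_ne_of_ne hji, h.label]
  parent := by simpa using h.parent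
  isCut := by simpa using h.isCut

theorem attaches_holds (h : SweepState ends pos p l C s) (hp : ∀ y, p y ≤ y) (hz : s.nvar 4 = z)
    {e : NExp} {i : Fin m} (he : e.val s = i) {a : ℕ} (hl : l i = top p C (z + 1) a) :
    (Test.attaches e).Holds s ↔ top p C z a = z := by
  have hle := hp (top p C (z + 1) a)
  simp only [Test.attaches, Test.disj_holds, Test.Holds, Test.nateq_holds, NExp.val, he, h.label,
    h.parent, h.isCut, hz, top_eq_iff, hl]
  grind

theorem runs_cutEdge (h : SweepState ends pos p l C s) (hz : s.nvar 4 = z) {e : NExp} {i : Fin m}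
    (he : e.val s = i) : (Cmd.cutEdge e).Runs N s fun s' => s'.nvar = s.nvar ∧
      SweepState ends pos p l (C ∪ ({l i} : Finset ℕ).erase z) s' := by
  have hlabel : e.label.val s = l i := by rw [NExp.val, he, h.label]
  have htest : (Test.nateq e.label (.var 4)).Holds s ↔ l i = z := by
    rw [Test.nateq_holds, hlabel, NExp.val, hz]
  refine .ite (fun hiz => .skip ⟨rfl, ?_⟩) fun hiz => .setNat ⟨rfl, ?_⟩ <;> rw [htest] at hiz
  · simpa [hiz] using h
  · rw [hlabel]
    refine ⟨h.toHasInput.setNat (by omega) _ _, by simpa using h.label, by simpa using h.parent,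
      fun y => ?_⟩
    by_cases hy : y = l i <;> simp [hy, hiz, NExp.val, h.isCut]

theorem runs_join (h : SweepState ends pos p (fun i => top p C (z + 1) (x i)) C s)
    (hp : ∀ y, p y ≤ y) (hz : s.nvar 4 = z) (hN : m ≤ N) : Cmd.join.Runs N s fun s' =>
      s'.nvar 4 = z ∧ SweepState ends pos p (fun i => top p C z (x i)) C s' := by
  refine (Cmd.Runs.forDown (I := fun k s' => s'.nvar 4 = z ∧ s'.nvar 5 = k ∧
    SweepState ends pos p (fun i => top p C (if k ≤ i then z else z + 1) (x i)) C s')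
    (h.edgeCount_val.trans_le hN) ?_ (fun k s' hs' => hs'.2.1) ?_).mono ?_
  · rw [h.edgeCount_val]
    refine ⟨by simpa using hz, by simp, ?_⟩
    simpa [Fin.is_lt _ |>.not_ge] using h.setVar (y := 5) (by omega) m
  · rintro k hk s₁ ⟨hz₁, -, h₁⟩
    lift k to Fin m using h.edgeCount_val ▸ hk
    have h₂ := h₁.setVar (y := 5) (by omega) k
    have htest := h₂.attaches_holds hp (z := z) (by simpa using hz₁) (e := .var 5) (i := k)
      (by simp [NExp.val]) (a := x k) (by simp)
    refine .ite (fun hk => .setNat ⟨by simpa using hz₁, by simp, ?_⟩)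
      fun hk => .skip ⟨by simpa using hz₁, by simp, ?_⟩ <;> rw [htest] at hk
    · convert h₂.setLabel k z using 1
      · grind
      · simp [NExp.val, hz₁]
    · convert h₂ using 2 with i
      rcases eq_or_ne i k with rfl | hik
      · simpa using top_eq_top_succ hk
      · grind
  · rintro s' ⟨hz', -, h'⟩
    exact ⟨hz', by simpa using h'⟩

end SweepState

namespace ResolveState

variable {γ : Type*} [DecidableEq γ] {S : Fin m → Fin m → Prop}

theorem setVar (h : ResolveState γ ends pos p x M z S s) {y : ℕ} (hy : 4 < y) (v : ℕ) :
    ResolveState γ ends pos p x M z S (s.setVar y v) := by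
  obtain ⟨hz, C, hs, hC, hS⟩ := h
  exact ⟨by simpa [hy.ne] using hz, C, hs.setVar (by omega) v, hC, hS⟩

theorem mono (h : ResolveState γ ends pos p x M z S s) {S' : Fin m → Fin m → Prop}
    (hS : ∀ i j, S' i j → S i j) : ResolveState γ ends pos p x M z S' s := by
  obtain ⟨hz, C, hs, hC, hSC⟩ := h
  exact ⟨hz, C, hs, hC, fun i j hij => hSC i j (hS i j hij)⟩

theorem runs_resolve (h : ResolveState γ ends pos p x M z S s) (hp : ∀ y, p y ≤ y)
    (hx : ∀ i, x i < M) (hinj : Function.Injective fun i => s((ends i).1, (ends i).2))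
    {a b : Fin m} (ha : s.nvar 5 = a) (hb : s.nvar 6 = b) :
    Cmd.resolve.Runs N s fun s' => s'.nvar = s.nvar ∧
      ResolveState γ ends pos p x M z (fun i j => S i j ∨ i = a ∧ j = b) s' := by
  obtain ⟨hz, C, hs, hC, hS⟩ := h
  have htest : (Test.conj (.conflict (.var 5) (.var 6))
      (.conj (.attaches (.var 5)) (.attaches (.var 6)))).Holds s ↔
      Conflicts pos s((ends a).1, (ends a).2) s((ends b).1, (ends b).2) ∧
        top p C z (x a) = z ∧ top p C z (x b) = z := by
    simp only [Test.Holds, hs.conflict_holds hinj (a := .var 5) ha (b := .var 6) hb,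
      hs.attaches_holds hp hz (e := .var 5) ha rfl, hs.attaches_holds hp hz (e := .var 6) hb rfl]
  refine .ite (fun h => ?_) fun h => .skip ⟨rfl, hz, C, hs, hC, ?_⟩ <;> rw [htest] at h
  · obtain ⟨hab, haz, hbz⟩ := h
    have hconf : ListConflict ends pos x (x a) (x b) := ⟨a, b, hab, rfl, rfl⟩
    have hne : x a ≠ x b := fun h => hC.separated _ _ hconf (by rw [h])
    refine .seq ((hs.runs_cutEdge hz (e := .var 5) ha).mono fun s₁ ⟨hvar₁, h₁⟩ => ?_)
    refine (h₁.runs_cutEdge (hvar₁ ▸ hz) (e := .var 6) (hvar₁ ▸ hb)).mono fun s₂ ⟨hvar₂, h₂⟩ => ?_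
    refine ⟨hvar₂.trans hvar₁, (hvar₂.trans hvar₁) ▸ hz, cut p C z (x a) (x b), ?_,
      hC.cut hconf (hx a) (hx b) haz hbz, ?_⟩
    · simp only [top_succ_cut haz hbz]
      convert h₂ using 1
      ext y
      simp [cut]
      tauto
    · rintro i j (hij | ⟨rfl, rfl⟩) hconf'
      · exact (hS i j hij hconf').imp (mt (top_eq_of_subset subset_cut))
          (mt (top_eq_of_subset subset_cut))
      · exact top_cut_ne haz hbz hne
  · rintro i j (hij | ⟨rfl, rfl⟩) hconf
    · exact hS i j hij hconf
    · tauto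

theorem runs_resolve_row (h : ResolveState γ ends pos p x M z S s) (hp : ∀ y, p y ≤ y)
    (hx : ∀ i, x i < M) (hinj : Function.Injective fun i => s((ends i).1, (ends i).2)) (hN : m ≤ N)
    {a : Fin m} (ha : s.nvar 5 = a) : (Cmd.forDown 6 .edgeCount .resolve).Runs N s fun s' =>
      s'.nvar 5 = a ∧ ResolveState γ ends pos p x M z (fun i j => S i j ∨ i = a) s' := by
  have hm := h.2.choose_spec.1.edgeCount_val
  refine (Cmd.Runs.forDown (I := fun k s' => s'.nvar 5 = a ∧ s'.nvar 6 = k ∧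
    ResolveState γ ends pos p x M z (fun i j => S i j ∨ i = a ∧ k ≤ j) s')
    (hm.trans_le hN) ?_ (fun k s' hs' => hs'.2.1) ?_).mono ?_
  · refine ⟨by simpa using ha, by simp, (h.setVar (by omega) _).mono fun i j hij => ?_⟩
    rw [hm] at hij
    exact hij.resolve_right fun h => absurd h.2 (by omega)
  · rintro k hk s₁ ⟨ha₁, -, h₁⟩
    lift k to Fin m using hm ▸ hk
    refine ((h₁.setVar (y := 6) (by omega) k).runs_resolve hp hx hinj (a := a) (b := k)
      (by simpa using ha₁) (by simp)).mono fun s₂ ⟨hvar, h₂⟩ => ?_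
    refine ⟨by simpa [hvar] using ha₁, by simp [hvar], h₂.mono fun i j hij => ?_⟩
    grind
  · rintro s' ⟨ha', -, h'⟩
    exact ⟨ha', h'.mono fun i j hij => by simpa using hij⟩

theorem runs_resolve_all (h : ResolveState γ ends pos p x M z (fun _ _ => False) s)
    (hp : ∀ y, p y ≤ y) (hx : ∀ i, x i < M)
    (hinj : Function.Injective fun i => s((ends i).1, (ends i).2)) (hN : m ≤ N) :
    (Cmd.forDown 5 .edgeCount (.forDown 6 .edgeCount .resolve)).Runs N s
      (ResolveState γ ends pos p x M z fun _ _ => True) := by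
  have hm := h.2.choose_spec.1.edgeCount_val
  refine (Cmd.Runs.forDown (I := fun k s' => s'.nvar 5 = k ∧
    ResolveState γ ends pos p x M z (fun i _ => k ≤ i) s')
    (hm.trans_le hN) ?_ (fun k s' hs' => hs'.1) ?_).mono ?_
  · exact ⟨by simp, (h.setVar (by omega) _).mono fun i _ hij => by omega⟩
  · rintro k hk s₁ ⟨-, h₁⟩
    lift k to Fin m using hm ▸ hk
    refine ((h₁.setVar (y := 5) (by omega) k).runs_resolve_row hp hx hinj hN (a := k)
      (by simp)).mono fun s₂ ⟨hk₂, h₂⟩ => ?_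
    exact ⟨hk₂, h₂.mono fun i _ hij => by grind⟩
  · rintro s' ⟨-, h'⟩
    exact h'.mono fun i _ _ => Nat.zero_le _

theorem exists_greedyInvariant (h : ResolveState γ ends pos p x M z (fun _ _ => True) s) :
    ∃ C, SweepState ends pos p (fun i => top p C (z + 1) (x i)) C s ∧
      GreedyInvariant γ p M (ListConflict ends pos x) z z C := by
  obtain ⟨-, C, hs, hC, hS⟩ := h
  refine ⟨C, hs, hC.descend ?_⟩
  rintro _ _ ⟨i, j, hij, rfl, rfl⟩ heq
  have haz := top_eq_of_top_eq_top heq (hC.separated _ _ ⟨i, j, hij, rfl, rfl⟩)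
  exact (hS i j trivial hij).elim (· haz) (· (heq ▸ haz))

end ResolveState

theorem SweepState.runs_sweep (γ : Type*) [DecidableEq γ] (h : SweepState ends pos p x ∅ s)
    (hp : ∀ y, p y ≤ y) (hxinj : Function.Injective x) (hx : ∀ i, x i < M)
    (hinj : Function.Injective fun i => s((ends i).1, (ends i).2)) (hM : s.nvar 1 + 1 = M)
    (hmN : m ≤ N) (hMN : M ≤ N) :
    Cmd.sweep.Runs N s fun s' => ∃ C, GreedyInvariant γ p M (ListConflict ends pos x) 0 0 C ∧
      ∀ i : Fin m, s'.narr 2 i = top p C 0 (x i) := by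
  have hval : (NExp.add .lastNode (.const 1)).val s = M := hM
  refine (Cmd.Runs.forDown (I := fun z s' => s'.nvar 4 = z ∧ ∃ C,
    SweepState ends pos p (fun i => top p C z (x i)) C s' ∧
      GreedyInvariant γ p M (ListConflict ends pos x) z z C)
    (hval.trans_le hMN) ?_ (fun z s' hs' => hs'.1) ?_).mono ?_
  · rw [hval]
    refine ⟨by simp, ∅, by simpa [top_of_le (hx _).le] using h.setVar (y := 4) (by omega) M,
      .empty ?_ ?_⟩
    · rintro _ _ ⟨i, j, hij, rfl, rfl⟩
      exact hxinj.ne fun hij' => (conflicts_mk_iff.1 hij).1 (by rw [hij'])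
    · rintro _ _ ⟨i, j, -, rfl, rfl⟩
      exact ⟨hx i, hx j⟩
  · rintro z - s₁ ⟨-, C, h₁, hC⟩
    have hres : ResolveState γ ends pos p x M z (fun _ _ => False) (s₁.setVar 4 z) :=
      ⟨by simp, C, h₁.setVar (by omega) z, hC.mono_left (by omega), fun _ _ h => h.elim⟩
    refine .seq ((hres.runs_resolve_all hp hx hinj hmN).mono fun s₂ h₂ => ?_)
    obtain ⟨C', hs₂, hC'⟩ := h₂.exists_greedyInvariant
    exact (hs₂.runs_join hp h₂.1 hmN).mono fun s₃ ⟨hz, h₃⟩ => ⟨hz, C', h₃, hC'⟩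
  · rintro s' ⟨-, C, h', hC⟩
    exact ⟨C, hC, h'.label⟩

theorem listConflict_eq {G : SimpleGraph (Fin (m + 1))} {enode : Sym2 (Fin (m + 1)) → ℕ}
    (hends : Set.BijOn (fun i => s((ends i).1, (ends i).2)) Set.univ G.edgeSet) :
    ListConflict ends pos (fun i => enode s((ends i).1, (ends i).2)) =
      NodesConflict G pos enode := by
  ext a b
  constructor
  · rintro ⟨i, j, hij, rfl, rfl⟩
    exact ⟨_, hends.mapsTo trivial, _, hends.mapsTo trivial, hij, rfl, rfl⟩
  · rintro ⟨e, he, f, hf, hef, rfl, rfl⟩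
    obtain ⟨i, -, rfl⟩ := hends.surjOn he
    obtain ⟨j, -, rfl⟩ := hends.surjOn hf
    exact ⟨i, j, hef, rfl, rfl⟩

theorem runs_decompose (γ : Type*) [DecidableEq γ] {G : SimpleGraph (Fin (m + 1))}
    (hG : G.Connected)
    (hends : Set.BijOn (fun i => s((ends i).1, (ends i).2)) Set.univ G.edgeSet)
    (hN : 2 * m + 1 ≤ N) :
    Cmd.decompose.Runs N (inputState (m + 1) ends pos) fun s => ∃ p node enode C,
      IsRooting G m p node enode ∧
      GreedyInvariant γ p (2 * m + 1) (NodesConflict G pos enode) 0 0 C ∧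
      ∀ i : Fin m, s.narr 2 i = top p C 0 (enode s((ends i).1, (ends i).2)) := by
  refine .seq ((RootingState.runs_root hG hends.surjOn (by omega)).mono fun s hs => ?_)
  obtain ⟨enode, hlabel, hR⟩ := hs.numbering.exists_isRooting hends
  have hinj := Set.injOn_univ.1 hends.injOn
  have hmem (i : Fin m) : s((ends i).1, (ends i).2) ∈ G.edgeSet := hends.mapsTo trivial
  have hsweep : SweepState ends pos (s.narr 4) (fun i => enode s((ends i).1, (ends i).2)) ∅ s :=
    { hs.toHasInput with
      label := fun i => (hlabel i).symm
      parent := rfl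
      isCut := by simp [hs.isCut] }
  refine (hsweep.runs_sweep γ (M := 2 * m + 1) (fun y => ?_) (fun i j hij => ?_) (fun i => ?_) hinj
    (by rw [hs.lastNode]) (by omega) hN).mono ?_
  · rcases y.eq_zero_or_pos with rfl | hy
    exacts [hR.parent_zero.le, (hR.parent_lt _ hy).le]
  · exact hinj (hR.enode_bijOn.injOn (hmem i) (hmem j) hij)
  · have := (hR.enode_bijOn.mapsTo (hmem i)).1
    omega
  · rintro s' ⟨C, hC, hlabel'⟩
    exact ⟨s.narr 4, _, enode, C, hR, listConflict_eq hends ▸ hC, hlabel'⟩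

end

end RealRAM

theorem mainTheorem7_general :
    ∃ (prog : RealRAM.Cmd) (p : Polynomial ℕ),
      ∀ (n : ℕ), 2 ≤ n →
      ∀ (G : SimpleGraph (Fin n)) [DecidableRel G.Adj], G.IsTree →
      ∀ (pos : Fin n → TreeDrawing.Plane), Function.Injective pos →
      ∀ (ends : Fin (n - 1) → Fin n × Fin n),
        Set.BijOn (fun i => s((ends i).1, (ends i).2)) Set.univ G.edgeSet →
      ∃ (t : ℕ) (s : RealRAM.State) (P : Finpartition G.edgeFinset),
        RealRAM.Exec prog (RealRAM.inputState n ends pos) t s ∧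
        t ≤ p.eval n ∧
        RealRAM.OutputsPartition s ends P ∧
        TreeDrawing.IsProperDecomposition pos P ∧
        (P.parts.card : ℤ) ≤ 2 * (TreeDrawing.optSize G pos : ℤ) - 1 := by
  refine ⟨.decompose, RealRAM.Cmd.decompose.timePoly.comp (2 * .X), ?_⟩
  intro n hn G _ hG pos hpos ends hends
  obtain ⟨m, rfl⟩ : ∃ m, n = m + 1 := ⟨n - 1, by omega⟩
  have : Nontrivial (Fin (m + 1)) := Fin.nontrivial_iff_two_le.2 hn
  obtain ⟨t, s, hexec, ht, p, node, enode, C, hR, hC, hs⟩ := RealRAM.runs_decompose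
    (Finset (Sym2 (Fin (m + 1)))) (pos := pos) hG.connected hends (N := 2 * (m + 1)) (by omega)
  refine ⟨t, s, TreeDrawing.fibrePartition G.edgeFinset fun e => TreeMulticut.top p C 0 (enode e),
    hexec, by simpa using ht, fun i j => ?_,
    hR.isProperDecomposition_of_greedyInvariant hpos hG.isAcyclic hC, ?_⟩
  · have hmem (i : Fin m) : s((ends i).1, (ends i).2) ∈ G.edgeFinset :=
      SimpleGraph.mem_edgeFinset.2 (hends.mapsTo trivial)
    rw [hs i, hs j, TreeDrawing.exists_mem_parts_fibrePartition_iff (hmem i) (hmem j)]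
  · have := hR.card_parts_lt_two_mul_optSize hpos hG hC
    omega

theorem mainTheorem7 :
    ∃ (prog : RealRAM.Cmd) (p : Polynomial ℕ),
      ∀ (n : ℕ), 2 ≤ n →
      ∀ (G : SimpleGraph (Fin n)) [DecidableRel G.Adj], G.IsTree →
      ∀ (pos : Fin n → TreeDrawing.Plane), TreeDrawing.IsPlaneDrawing G pos →
      ∀ (ends : Fin (n - 1) → Fin n × Fin n),
        Set.BijOn (fun i => s((ends i).1, (ends i).2)) Set.univ G.edgeSet →
      ∃ (t : ℕ) (s : RealRAM.State) (P : Finpartition G.edgeFinset),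
        RealRAM.Exec prog (RealRAM.inputState n ends pos) t s ∧
        t ≤ p.eval n ∧
        RealRAM.OutputsPartition s ends P ∧
        TreeDrawing.IsProperDecomposition pos P ∧
        (P.parts.card : ℤ) ≤ 2 * (TreeDrawing.optSize G pos : ℤ) - 1 := by
  obtain ⟨prog, p, h⟩ := mainTheorem7_general
  exact ⟨prog, p, fun n hn G _ hG pos hpos => h n hn G hG pos hpos.injective⟩
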